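/- Let $R$ be an integral domain such that $R/(m)$ is finite for every $m\in R^\times:=R\setminus\{0\}$, and let $K$ be its field of fractions. Let $\mathfrak A[R]$ be the universal C*-algebra generated by isometries $s_m$ ($m\in R^\times$) and unitaries $u^n$ ($n\in R$) subject to $s_ms_{m'}=s_{mm'}$, $u^nu^{n'}=u^{n+n'}$, $s_mu^n=u^{mn}s_m$ and $\sum_{l+(m)\in R/(m)}u^ls_ms_m^*u^{-l}=1$. Let $K\rtimes K^\times$ be the group of pairs $(u,w)$ with $(u,w)(u',w')=(u+u'w,ww')$, and let $C^*_p(K\rtimes K^\times,\mathcal R)$ be the universal C*-algebra generated by symbols $[g]$, $g\in K\rtimes K^\times$, subject to the partial representation relations $[1]=1$, $[g^{-1}]=[g]^*$, $[g][h][h^{-1}]=[gh][h^{-1}]$ and, with $e_g=[g][g^{-1}]$, to the relations $\mathcal R$: $e_{(n,1)}=1$ for $n\in R$, $e_{(0,1/m)}=1$ and $\sum_{n+(m)\in R/(m)}e_{(n,m)}=1$ for $m\in R^\times$. Let $\Psi:\mathfrak A[R]\to C^*_p(K\rtimes K^\times,\mathcal R)$ be the $*$-homomorphism with $\Psi(u^n)=[n,1]$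 and $\Psi(s_m)=[0,m]$. Then the following hold. (1) $\Psi$ is bijective. (2) There is exactly one faithful conditional expectation $E$ of $C^*_p(K\rtimes K^\times,\mathcal R)$ onto its C*-subalgebra $C^*(\{e_g\}_{g\in K\rtimes K^\times})$ such that $E([g_1]\cdots[g_k])=\delta_{g_1\cdots g_k,1}\,[g_1]\cdots[g_k]$ for all $k\ge 0$ and $g_1,\dots,g_k\in K\rtimes K^\times$. (3) There is exactly one faithful conditional expectation $\Theta$ of $\mathfrak A[R]$ onto its C*-subalgebra generated by the elements $s_{m'}^*u^ns_ms_m^*u^{-n}s_{m'}$ ($m,m'\in R^\times$, $n\in R$) such that $\Theta(s_{m''}^*u^ns_ms_m^*u^{-n'}s_{m'})=\delta_{m',m''}\delta_{n,n'}\,s_{m'}^*u^ns_ms_m^*u^{-n}s_{m'}$ for all $m,m',m''\in R^\times$ and $n,n'\in R$. (4) $E\circ\Psi=\Psi\circ\Theta$. -/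

import Mathlib

open scoped nonZeroDivisors

noncomputable section

/-! ### The free unital `*`-algebra on a set of generators -/

/-- The free unital complex `*`-algebra on `X`: noncommutative polynomials with complex
coefficients in the variables `x` (left summand) and `x^*` (right summand). -/
def FreeStarAlgebra (X : Type*) : Type _ := FreeAlgebra ℂ (X ⊕ X)

namespace FreeStarAlgebra

variable {X : Type*}

instance : Ring (FreeStarAlgebra X) := inferInstanceAs (Ring (FreeAlgebra ℂ (X ⊕ X)))

instance : Algebra ℂ (FreeStarAlgebra X) := inferInstanceAs (Algebra ℂ (FreeAlgebra ℂ (X ⊕ X)))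

/-- The generator `x`. -/
def of (x : X) : FreeStarAlgebra X := FreeAlgebra.ι ℂ (Sum.inl x)

/-- The adjoint of the generator `x`. -/
def ofStar (x : X) : FreeStarAlgebra X := FreeAlgebra.ι ℂ (Sum.inr x)

theorem induct {motive : FreeStarAlgebra X → Prop}
    (scalar : ∀ c : ℂ, motive (algebraMap ℂ (FreeStarAlgebra X) c))
    (of : ∀ x, motive (of x)) (ofStar : ∀ x, motive (ofStar x))
    (mul : ∀ a b, motive a → motive b → motive (a * b))
    (add : ∀ a b, motive a → motive b → motive (a + b)) (a : FreeStarAlgebra X) : motive a :=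
  FreeAlgebra.induction ℂ (X ⊕ X) (motive := motive) scalar
    (fun x => Sum.rec (motive := fun x => motive (FreeAlgebra.ι ℂ x)) of ofStar x) mul add a

/-- The algebra homomorphism that sends `x` to `f x` and `x^*` to `g x`. -/
def liftAux {B : Type*} [Ring B] [Algebra ℂ B] (f g : X → B) : FreeStarAlgebra X →ₐ[ℂ] B :=
  (FreeAlgebra.lift ℂ (Sum.elim f g) : FreeAlgebra ℂ (X ⊕ X) →ₐ[ℂ] B)

theorem liftAux_of {B : Type*} [Ring B] [Algebra ℂ B] (f g : X → B) (x : X) :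
    liftAux f g (of x) = f x :=
  FreeAlgebra.lift_ι_apply (R := ℂ) (Sum.elim f g) (Sum.inl x)

theorem liftAux_ofStar {B : Type*} [Ring B] [Algebra ℂ B] (f g : X → B) (x : X) :
    liftAux f g (ofStar x) = g x :=
  FreeAlgebra.lift_ι_apply (R := ℂ) (Sum.elim f g) (Sum.inr x)

/-- The opposite ring of the free `*`-algebra, with the conjugate scalar multiplication. -/
def ConjOpposite (X : Type*) : Type _ := (FreeStarAlgebra X)ᵐᵒᵖ

instance : Ring (ConjOpposite X) := inferInstanceAs (Ring (FreeStarAlgebra X)ᵐᵒᵖ)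

instance : Algebra ℂ (ConjOpposite X) :=
  RingHom.toAlgebra' ((algebraMap ℂ (FreeStarAlgebra X)ᵐᵒᵖ).comp (starRingEnd ℂ))
    (fun c a => Algebra.commutes (A := (FreeStarAlgebra X)ᵐᵒᵖ) (starRingEnd ℂ c) a)

/-- The involution, as a ring homomorphism to the opposite ring: it is conjugate linear, reverses
products and interchanges `x` and `x^*`. -/
def starHom (X : Type*) : FreeStarAlgebra X →+* (FreeStarAlgebra X)ᵐᵒᵖ :=
  (liftAux (B := ConjOpposite X) (fun x => MulOpposite.op (ofStar x))
    (fun x => MulOpposite.op (of x))).toRingHom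

theorem starHom_of (x : X) : starHom X (of x) = MulOpposite.op (ofStar x) :=
  liftAux_of (B := ConjOpposite X) _ _ x

theorem starHom_ofStar (x : X) : starHom X (ofStar x) = MulOpposite.op (of x) :=
  liftAux_ofStar (B := ConjOpposite X) _ _ x

theorem starHom_algebraMap (c : ℂ) : starHom X (algebraMap ℂ (FreeStarAlgebra X) c) =
    MulOpposite.op (algebraMap ℂ (FreeStarAlgebra X) (starRingEnd ℂ c)) :=
  AlgHom.commutes (liftAux (B := ConjOpposite X) (fun x => MulOpposite.op (ofStar x))
    (fun x => MulOpposite.op (of x))) c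

instance : StarRing (FreeStarAlgebra X) where
  star a := (starHom X a).unop
  star_involutive a := by
    induction a using induct with
    | scalar c => simp [starHom_algebraMap]
    | of x => simp [starHom_of, starHom_ofStar]
    | ofStar x => simp [starHom_of, starHom_ofStar]
    | mul a b ha hb => simp [ha, hb]
    | add a b ha hb => simp [ha, hb]
  star_mul a b := by simp
  star_add a b := by simp

theorem star_of (x : X) : star (of x) = ofStar x := by
  change (starHom X (of x)).unop = _
  rw [starHom_of, MulOpposite.unop_op]

theorem star_ofStar (x : X) : star (ofStar x) = of x := by
  change (starHom X (ofStar x)).unop = _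
  rw [starHom_ofStar, MulOpposite.unop_op]

theorem star_algebraMap (c : ℂ) : star (algebraMap ℂ (FreeStarAlgebra X) c) =
    algebraMap ℂ (FreeStarAlgebra X) (starRingEnd ℂ c) := by
  change (starHom X (algebraMap ℂ (FreeStarAlgebra X) c)).unop = _
  rw [starHom_algebraMap, MulOpposite.unop_op]

instance : StarModule ℂ (FreeStarAlgebra X) where
  star_smul c a := by
    rw [Algebra.smul_def, Algebra.smul_def, star_mul, star_algebraMap, Algebra.commutes]
    rfl

/-- Evaluation of noncommutative `*`-polynomials at a family of elements of a `*`-algebra. -/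
def eval {B : Type*} [Ring B] [StarRing B] [Algebra ℂ B] [StarModule ℂ B] (f : X → B) :
    FreeStarAlgebra X →⋆ₐ[ℂ] B where
  __ := liftAux f (fun x => star (f x))
  map_star' a := by
    change liftAux f (fun x => star (f x)) (star a) = star (liftAux f (fun x => star (f x)) a)
    induction a using induct with
    | scalar c => rw [star_algebraMap, AlgHom.commutes, AlgHom.commutes]; exact algebraMap_star_comm c
    | of x => rw [star_of, liftAux_of, liftAux_ofStar]
    | ofStar x => rw [star_ofStar, liftAux_of, liftAux_ofStar, star_star]
    | mul a b ha hb => rw [star_mul, map_mul, map_mul, ha, hb, star_mul]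
    | add a b ha hb => rw [star_add, map_add, map_add, ha, hb, star_add]

theorem eval_of {B : Type*} [Ring B] [StarRing B] [Algebra ℂ B] [StarModule ℂ B] (f : X → B)
    (x : X) : eval f (of x) = f x :=
  liftAux_of f _ x

end FreeStarAlgebra

/-! ### The universal C*-algebra of a set of generators and relations -/

/-- The C*-seminorms on the free `*`-algebra on `X` that vanish on all relations. -/
def cstarSeminorms {X : Type*} (rel : Set (FreeStarAlgebra X)) :
    Set (Seminorm ℂ (FreeStarAlgebra X)) :=
  {p | (∀ a b, p (a * b) ≤ p a * p b) ∧ (∀ a, p (star a * a) = p a ^ 2) ∧ ∀ r ∈ rel, p r = 0}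

/-- The relations bound the norm of every `*`-polynomial; this is the condition for the universal
C*-algebra with these relations to exist. -/
class BoundedRelations {X : Type*} (rel : Set (FreeStarAlgebra X)) : Prop where
  bddAbove : BddAbove (cstarSeminorms rel)

namespace UniversalCStarAlgebra

variable {X : Type*} (rel : Set (FreeStarAlgebra X))

/-- The largest C*-seminorm on the free `*`-algebra vanishing on the relations. -/
def maxSeminorm : Seminorm ℂ (FreeStarAlgebra X) := sSup (cstarSeminorms rel)

variable {rel}

theorem zero_mem : (0 : Seminorm ℂ (FreeStarAlgebra X)) ∈ cstarSeminorms rel :=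
  ⟨by simp, by simp, by simp⟩

theorem star_le {p : Seminorm ℂ (FreeStarAlgebra X)} (hp : p ∈ cstarSeminorms rel)
    (a : FreeStarAlgebra X) : p (star a) = p a := by
  have key : ∀ a, p a ≤ p (star a) := by
    intro a
    have h1 := hp.2.1 a
    have h2 := hp.1 (star a) a
    have h3 := apply_nonneg p a
    have h4 := apply_nonneg p (star a)
    nlinarith
  refine le_antisymm ?_ (key a)
  simpa using key (star a)

variable [BoundedRelations rel]

theorem le_maxSeminorm {p : Seminorm ℂ (FreeStarAlgebra X)} (hp : p ∈ cstarSeminorms rel) :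
    p ≤ maxSeminorm rel :=
  le_csSup BoundedRelations.bddAbove hp

theorem maxSeminorm_le {a : FreeStarAlgebra X} {C : ℝ} (h : ∀ p ∈ cstarSeminorms rel, p a ≤ C) :
    maxSeminorm rel a ≤ C := by
  rw [maxSeminorm, Seminorm.sSup_apply BoundedRelations.bddAbove]
  have : Nonempty (cstarSeminorms rel) := ⟨⟨0, zero_mem⟩⟩
  exact ciSup_le fun p => h p.1 p.2

theorem maxSeminorm_mem : maxSeminorm rel ∈ cstarSeminorms rel := by
  refine ⟨fun a b => ?_, fun a => le_antisymm ?_ ?_, fun r hr => ?_⟩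
  · refine maxSeminorm_le fun p hp => (hp.1 a b).trans ?_
    exact mul_le_mul (le_maxSeminorm hp a) (le_maxSeminorm hp b) (apply_nonneg _ _)
      (apply_nonneg _ _)
  · refine maxSeminorm_le fun p hp => ?_
    rw [hp.2.1]
    exact pow_le_pow_left₀ (apply_nonneg _ _) (le_maxSeminorm hp a) 2
  · have h0 := apply_nonneg (maxSeminorm rel) (star a * a)
    rw [← Real.sq_sqrt h0]
    refine pow_le_pow_left₀ (apply_nonneg _ _) (maxSeminorm_le fun p hp => ?_) 2
    exact Real.le_sqrt_of_sq_le ((hp.2.1 a).symm.le.trans (le_maxSeminorm hp (star a * a)))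
  · exact le_antisymm (maxSeminorm_le fun p hp => (hp.2.2 r hr).le) (apply_nonneg _ _)

/-- The free `*`-algebra, as a ring seminormed by the largest C*-seminorm. -/
def Pre {X : Type*} (rel : Set (FreeStarAlgebra X)) [BoundedRelations rel] : Type _ :=
  FreeStarAlgebra X

instance : Ring (Pre rel) := inferInstanceAs (Ring (FreeStarAlgebra X))

instance : Algebra ℂ (Pre rel) := inferInstanceAs (Algebra ℂ (FreeStarAlgebra X))

instance : StarRing (Pre rel) := inferInstanceAs (StarRing (FreeStarAlgebra X))

instance : StarModule ℂ (Pre rel) := inferInstanceAs (StarModule ℂ (FreeStarAlgebra X))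

instance : SeminormedRing (Pre rel) where
  __ := (inferInstance : Ring (Pre rel))
  __ := AddGroupSeminorm.toSeminormedAddCommGroup (E := Pre rel) (maxSeminorm rel).toAddGroupSeminorm
  norm_mul_le := maxSeminorm_mem.1

instance : NormedAlgebra ℂ (Pre rel) where
  norm_smul_le c a := (map_smul_eq_mul (maxSeminorm rel) c a).le

theorem norm_star_pre (a : Pre rel) : ‖star a‖ = ‖a‖ := star_le maxSeminorm_mem a

theorem norm_star_mul_pre (a : Pre rel) : ‖star a * a‖ = ‖a‖ ^ 2 := maxSeminorm_mem.2.1 a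

end UniversalCStarAlgebra

/-- The universal C*-algebra generated by `X` subject to the relations `r = 0` for `r ∈ rel`: the
Hausdorff completion of the free `*`-algebra on `X` for the largest C*-seminorm that vanishes on
the relations. -/
def UniversalCStarAlgebra {X : Type*} (rel : Set (FreeStarAlgebra X)) [BoundedRelations rel] :
    Type _ := UniformSpace.Completion (UniversalCStarAlgebra.Pre rel)

namespace UniversalCStarAlgebra

open UniformSpace

variable {X : Type*} {rel : Set (FreeStarAlgebra X)} [BoundedRelations rel]

instance : NormedRing (UniversalCStarAlgebra rel) := inferInstanceAs (NormedRing (Completion (Pre rel)))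

instance : CompleteSpace (UniversalCStarAlgebra rel) :=
  inferInstanceAs (CompleteSpace (Completion (Pre rel)))

instance : NormedAlgebra ℂ (UniversalCStarAlgebra rel) where
  __ := (inferInstanceAs (Algebra ℂ (Completion (Pre rel))) : Algebra ℂ (UniversalCStarAlgebra rel))
  norm_smul_le := norm_smul_le (α := ℂ) (β := Completion (Pre rel))

/-- The class of a `*`-polynomial in the universal C*-algebra. -/
def mk (a : FreeStarAlgebra X) : UniversalCStarAlgebra rel :=
  Completion.coe' (α := Pre rel) a

theorem norm_mk (a : FreeStarAlgebra X) :
    ‖(mk a : UniversalCStarAlgebra rel)‖ = maxSeminorm rel a :=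
  Completion.norm_coe (E := Pre rel) a

theorem mk_add (a b : FreeStarAlgebra X) :
    (mk (a + b) : UniversalCStarAlgebra rel) = mk a + mk b :=
  Completion.coe_add (α := Pre rel) a b

theorem mk_mul (a b : FreeStarAlgebra X) :
    (mk (a * b) : UniversalCStarAlgebra rel) = mk a * mk b :=
  Completion.coe_mul (α := Pre rel) a b

theorem mk_smul (c : ℂ) (a : FreeStarAlgebra X) :
    (mk (c • a) : UniversalCStarAlgebra rel) = c • mk a :=
  Completion.coe_smul (X := Pre rel) c a

theorem mk_induct {P : UniversalCStarAlgebra rel → Prop} (a : UniversalCStarAlgebra rel)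
    (hc : IsClosed {a | P a}) (h : ∀ a, P (mk a)) : P a :=
  Completion.induction_on (α := Pre rel) a hc h

theorem uniformContinuous_star_pre : UniformContinuous (star : Pre rel → Pre rel) :=
  (AddMonoidHomClass.isometry_of_norm (starAddEquiv : Pre rel ≃+ Pre rel)
    norm_star_pre).uniformContinuous

instance : Star (UniversalCStarAlgebra rel) := ⟨Completion.map (star : Pre rel → Pre rel)⟩

theorem continuous_star' : Continuous (star : UniversalCStarAlgebra rel → _) :=
  Completion.continuous_map (α := Pre rel) (β := Pre rel)

theorem star_mk (a : FreeStarAlgebra X) :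
    star (mk a : UniversalCStarAlgebra rel) = mk (star a) :=
  Completion.map_coe (α := Pre rel) (β := Pre rel) uniformContinuous_star_pre a

instance : StarRing (UniversalCStarAlgebra rel) where
  star_involutive a := by
    induction a using mk_induct with
    | hc => exact isClosed_eq (continuous_star'.comp continuous_star') continuous_id
    | h a => rw [star_mk, star_mk, star_star]
  star_mul a b := by
    induction a using mk_induct with
    | hc => exact isClosed_eq (continuous_star'.comp (by fun_prop))
              (continuous_const.mul continuous_star')
    | h a =>
      induction b using mk_induct with
      | hc => exact isClosed_eq (continuous_star'.comp (by fun_prop))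
                (continuous_star'.mul continuous_const)
      | h b => rw [← mk_mul, star_mk, star_mk, star_mk, star_mul, mk_mul]
  star_add a b := by
    induction a using mk_induct with
    | hc => exact isClosed_eq (continuous_star'.comp (by fun_prop))
              (continuous_star'.add continuous_const)
    | h a =>
      induction b using mk_induct with
      | hc => exact isClosed_eq (continuous_star'.comp (by fun_prop))
                (continuous_const.add continuous_star')
      | h b => rw [← mk_add, star_mk, star_mk, star_mk, star_add, mk_add]

instance : CStarRing (UniversalCStarAlgebra rel) where
  norm_mul_self_le a := by
    induction a using mk_induct with
    | hc => exact isClosed_le (by fun_prop) ((continuous_star'.mul continuous_id).norm)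
    | h a =>
      rw [star_mk, ← mk_mul, norm_mk, norm_mk, maxSeminorm_mem.2.1, sq]

instance : StarModule ℂ (UniversalCStarAlgebra rel) where
  star_smul c a := by
    induction a using mk_induct with
    | hc => exact isClosed_eq (continuous_star'.comp (continuous_const_smul c))
              (continuous_star'.const_smul (star c))
    | h a => rw [← mk_smul, star_mk, star_mk, star_smul, mk_smul]

instance : CStarAlgebra (UniversalCStarAlgebra rel) where

/-- The generator of the universal C*-algebra that belongs to `x`. -/
def gen (x : X) : UniversalCStarAlgebra rel := mk (FreeStarAlgebra.of x)

/-- The canonical map from the free `*`-algebra, as a `*`-homomorphism. -/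
def mkHom : FreeStarAlgebra X →⋆ₐ[ℂ] UniversalCStarAlgebra rel where
  toFun := mk
  map_one' := Completion.coe_one (α := Pre rel)
  map_mul' := mk_mul
  map_zero' := Completion.coe_zero (α := Pre rel)
  map_add' := mk_add
  commutes' c := by
    rw [Algebra.algebraMap_eq_smul_one, Algebra.algebraMap_eq_smul_one, mk_smul]
    exact congrArg (c • ·) (Completion.coe_one (α := Pre rel))
  map_star' a := (star_mk a).symm

theorem mkHom_of (x : X) : (mkHom (FreeStarAlgebra.of x) : UniversalCStarAlgebra rel) = gen x := rfl

/-- The relations hold in the universal C*-algebra. -/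
theorem mkHom_rel {r : FreeStarAlgebra X} (hr : r ∈ rel) :
    (mkHom r : UniversalCStarAlgebra rel) = 0 := by
  rw [← norm_eq_zero]
  exact (norm_mk r).trans (maxSeminorm_mem.2.2 r hr)

/-! The universal property. -/

theorem norm_eval_le {B : Type*} [CStarAlgebra B] (f : X → B)
    (hf : ∀ r ∈ rel, FreeStarAlgebra.eval f r = 0) (a : FreeStarAlgebra X) :
    ‖FreeStarAlgebra.eval f a‖ ≤ maxSeminorm rel a := by
  have h : (normSeminorm ℂ B).comp (FreeStarAlgebra.eval f).toAlgHom.toLinearMap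
      ∈ cstarSeminorms rel := by
    refine ⟨fun a b => ?_, fun a => ?_, fun r hr => ?_⟩
    · change ‖FreeStarAlgebra.eval f (a * b)‖ ≤ _
      rw [map_mul]
      exact norm_mul_le _ _
    · change ‖FreeStarAlgebra.eval f (star a * a)‖ = ‖FreeStarAlgebra.eval f a‖ ^ 2
      rw [map_mul, map_star, CStarRing.norm_star_mul_self, sq]
    · change ‖FreeStarAlgebra.eval f r‖ = 0
      rw [hf r hr, norm_zero]
  exact le_maxSeminorm h a

/-- Evaluation as a ring homomorphism on the seminormed free `*`-algebra. -/
def evalPre {B : Type*} [CStarAlgebra B] (f : X → B) : Pre rel →+* B :=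
  (FreeStarAlgebra.eval f).toAlgHom.toRingHom

theorem continuous_evalPre {B : Type*} [CStarAlgebra B] (f : X → B)
    (hf : ∀ r ∈ rel, FreeStarAlgebra.eval f r = 0) :
    Continuous (evalPre f : Pre rel →+* B) :=
  AddMonoidHomClass.continuous_of_bound (evalPre f : Pre rel →+* B) 1
    (fun a => (norm_eval_le f hf a).trans (one_mul (maxSeminorm rel a)).ge)

/-- The `*`-homomorphism from the universal C*-algebra that is given by a family of elements of a
C*-algebra satisfying the relations. -/
def lift {B : Type*} [CStarAlgebra B] (f : X → B)
    (hf : ∀ r ∈ rel, FreeStarAlgebra.eval f r = 0) : UniversalCStarAlgebra rel →⋆ₐ[ℂ] B :=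
  have hmk : ∀ a, Completion.extensionHom (evalPre f) (continuous_evalPre f hf)
      (mk a : UniversalCStarAlgebra rel) = FreeStarAlgebra.eval f a :=
    fun a => Completion.extensionHom_coe (evalPre f) (continuous_evalPre f hf) a
  have hcont : Continuous (fun a : UniversalCStarAlgebra rel =>
      Completion.extensionHom (evalPre f) (continuous_evalPre f hf) a) :=
    Completion.continuous_extension
  { Completion.extensionHom (evalPre f) (continuous_evalPre f hf) with
    commutes' := fun c => by
      have h : algebraMap ℂ (UniversalCStarAlgebra rel) c = mk (algebraMap ℂ _ c) :=
        (AlgHomClass.commutes (mkHom (rel := rel)) c).symm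
      rw [h]
      exact (hmk _).trans (AlgHomClass.commutes (FreeStarAlgebra.eval f) c)
    map_star' := fun a => by
      change Completion.extensionHom (evalPre f) (continuous_evalPre f hf)
        (star a : UniversalCStarAlgebra rel) = star (Completion.extensionHom (evalPre f) (continuous_evalPre f hf) a)
      induction a using mk_induct with
      | hc => exact isClosed_eq (hcont.comp continuous_star') hcont.star
      | h a => rw [star_mk, hmk, hmk, map_star] }

theorem lift_gen {B : Type*} [CStarAlgebra B] (f : X → B)
    (hf : ∀ r ∈ rel, FreeStarAlgebra.eval f r = 0) (x : X) :
    lift f hf (gen x : UniversalCStarAlgebra rel) = f x :=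
  (Completion.extensionHom_coe (evalPre f) (continuous_evalPre f hf)
    (FreeStarAlgebra.of x)).trans (FreeStarAlgebra.eval_of f x)

end UniversalCStarAlgebra

/-- The relations are bounded if they bound the norms of the generators. -/
theorem BoundedRelations.of_generators {X : Type*} {rel : Set (FreeStarAlgebra X)}
    (h : ∀ p ∈ cstarSeminorms rel, ∀ x, p (FreeStarAlgebra.of x) ≤ 1) : BoundedRelations rel where
  bddAbove := by
    rw [Seminorm.bddAbove_iff]
    have h1 : ∀ p ∈ cstarSeminorms rel, p 1 ≤ 1 := fun p hp => by
      have := hp.2.1 1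
      rw [star_one, one_mul] at this
      nlinarith [apply_nonneg p 1]
    suffices key : ∀ a, ∃ C : ℝ, ∀ p ∈ cstarSeminorms rel, p a ≤ C by
      choose C hC using key
      exact ⟨C, by rintro _ ⟨p, hp, rfl⟩ a; exact hC a p hp⟩
    intro a
    induction a using FreeStarAlgebra.induct with
    | scalar c =>
      refine ⟨‖c‖, fun p hp => ?_⟩
      rw [Algebra.algebraMap_eq_smul_one, map_smul_eq_mul]
      nlinarith [h1 p hp, norm_nonneg c]
    | of x => exact ⟨1, fun p hp => h p hp x⟩
    | ofStar x =>
      refine ⟨1, fun p hp => ?_⟩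
      rw [← FreeStarAlgebra.star_of, UniversalCStarAlgebra.star_le hp]
      exact h p hp x
    | mul a b ha hb =>
      obtain ⟨C, hC⟩ := ha
      obtain ⟨D, hD⟩ := hb
      refine ⟨C * D, fun p hp => (hp.1 a b).trans ?_⟩
      exact mul_le_mul (hC p hp) (hD p hp) (apply_nonneg _ _)
        ((apply_nonneg p a).trans (hC p hp))
    | add a b ha hb =>
      obtain ⟨C, hC⟩ := ha
      obtain ⟨D, hD⟩ := hb
      exact ⟨C + D, fun p hp => (map_add_le_add p a b).trans (add_le_add (hC p hp) (hD p hp))⟩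

/-- The norm of a partial isometry is at most `1`. -/
theorem cstarSeminorm_le_one {X : Type*} {rel : Set (FreeStarAlgebra X)}
    {p : Seminorm ℂ (FreeStarAlgebra X)} (hp : p ∈ cstarSeminorms rel) (x : FreeStarAlgebra X)
    (h : p (x * star x * x - x) = 0) : p x ≤ 1 := by
  have h1 : p (star x * x * (star x * x) - star x * x) ≤ 0 := by
    have : star x * x * (star x * x) - star x * x = star x * (x * star x * x - x) := by
      noncomm_ring
    rw [this]
    exact (hp.1 _ _).trans (by rw [h, mul_zero])
  have h2 : p (star x * x * (star x * x)) = p (star x * x) ^ 2 := by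
    have := hp.2.1 (star x * x)
    rwa [star_mul, star_star] at this
  have h3 := abs_sub_map_le_sub p (star x * x * (star x * x)) (star x * x)
  have h4 := abs_nonpos_iff.mp (h3.trans h1)
  rw [h2, hp.2.1] at h4
  have h5 := apply_nonneg p x
  by_contra! hlt
  nlinarith [one_lt_pow₀ hlt (two_ne_zero)]

/-! ### The partial group algebra of a group with relations -/

namespace PartialGroupAlgebra

open FreeStarAlgebra

variable (G : Type*) [Group G]

/-- The relations that say that `g ↦ [g]` is a partial representation of `G`. -/
inductive PartialRepRel : FreeStarAlgebra G → Prop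
  | one : PartialRepRel (of 1 - 1)
  | inv (g : G) : PartialRepRel (of g⁻¹ - star (of g))
  | mul (g h : G) : PartialRepRel (of g * of h * of h⁻¹ - of (g * h) * of h⁻¹)

/-- Substitutes `e_g = [g][g⁻¹]` for the variable `g` of a noncommutative polynomial. -/
def substE : FreeAlgebra ℂ G →ₐ[ℂ] FreeStarAlgebra G :=
  FreeAlgebra.lift ℂ (fun g => of g * of g⁻¹)

variable {G}

/-- All defining relations of the partial group algebra with relations `𝓡`. Here `𝓡` is a set of
noncommutative polynomials `∑ i, λ i * ∏ j, g i j` in the elements of `G`; such a polynomial stands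
for the relation `∑ i, λ i * ∏ j, e_{g i j} = 0`. -/
def relations (𝓡 : Set (FreeAlgebra ℂ G)) : Set (FreeStarAlgebra G) :=
  {r | PartialRepRel G r} ∪ substE G '' 𝓡

instance (𝓡 : Set (FreeAlgebra ℂ G)) : BoundedRelations (relations 𝓡) :=
  BoundedRelations.of_generators fun p hp g => by
    refine cstarSeminorm_le_one hp _ (le_antisymm ?_ (apply_nonneg _ _))
    have e : of g * star (of g) * of g - of g =
        (of g * of g⁻¹ * of g⁻¹⁻¹ - of (g * g⁻¹) * of g⁻¹⁻¹)
        - of g * (of g⁻¹ - star (of g)) * of g + (of 1 - 1) * of g := by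
      rw [inv_inv, mul_inv_cancel]
      noncomm_ring
    have z1 : p (of g * of g⁻¹ * of g⁻¹⁻¹ - of (g * g⁻¹) * of g⁻¹⁻¹) = 0 :=
      hp.2.2 _ (Or.inl (.mul g g⁻¹))
    have z2 : p (of g * (of g⁻¹ - star (of g)) * of g) ≤ 0 := by
      refine (hp.1 _ _).trans ((mul_le_mul_of_nonneg_right (hp.1 _ _) (apply_nonneg _ _)).trans ?_)
      rw [hp.2.2 _ (Or.inl (.inv g)), mul_zero, zero_mul]
    have z3 : p ((of 1 - 1) * of g) ≤ 0 := by
      refine (hp.1 _ _).trans ?_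
      rw [hp.2.2 _ (Or.inl .one), zero_mul]
    rw [e]
    refine (map_add_le_add p _ _).trans ?_
    have := map_sub_le_add p (of g * of g⁻¹ * of g⁻¹⁻¹ - of (g * g⁻¹) * of g⁻¹⁻¹)
      (of g * (of g⁻¹ - star (of g)) * of g)
    linarith

end PartialGroupAlgebra

/-- The partial group algebra `C*_p(G, 𝓡)`: the universal C*-algebra generated by the symbols `[g]`,
`g ∈ G`, subject to `[e] = 1`, `[g⁻¹] = [g]^*`, `[g][h][h⁻¹] = [gh][h⁻¹]` and to the relations `𝓡`
between the elements `e_g = [g][g⁻¹]`. -/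
abbrev PartialGroupAlgebra {G : Type*} [Group G] (𝓡 : Set (FreeAlgebra ℂ G)) : Type _ :=
  UniversalCStarAlgebra (PartialGroupAlgebra.relations 𝓡)

namespace PartialGroupAlgebra

variable {G : Type*} [Group G] {𝓡 : Set (FreeAlgebra ℂ G)}

/-- The generator `[g]`. -/
def bracket (g : G) : PartialGroupAlgebra 𝓡 := UniversalCStarAlgebra.gen g

/-- The projection `e_g = [g][g⁻¹]`. -/
def e (g : G) : PartialGroupAlgebra 𝓡 := bracket g * bracket g⁻¹

open UniversalCStarAlgebra FreeStarAlgebra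

theorem bracket_one : (bracket 1 : PartialGroupAlgebra 𝓡) = 1 := by
  have := mkHom_rel (rel := relations 𝓡) (Or.inl (.one))
  rwa [map_sub, map_one, sub_eq_zero, mkHom_of] at this

theorem star_bracket (g : G) : star (bracket g : PartialGroupAlgebra 𝓡) = bracket g⁻¹ := by
  have := mkHom_rel (rel := relations 𝓡) (Or.inl (.inv g))
  rw [map_sub, map_star, sub_eq_zero, mkHom_of, mkHom_of] at this
  exact this.symm

theorem bracket_mul (g h : G) : (bracket g * bracket h * bracket h⁻¹ : PartialGroupAlgebra 𝓡) =
    bracket (g * h) * bracket h⁻¹ := by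
  have := mkHom_rel (rel := relations 𝓡) (Or.inl (.mul g h))
  rwa [map_sub, map_mul, map_mul, map_mul, sub_eq_zero, mkHom_of, mkHom_of, mkHom_of,
    mkHom_of] at this

theorem lift_e {f : FreeAlgebra ℂ G} (hf : f ∈ 𝓡) :
    FreeAlgebra.lift ℂ (e : G → PartialGroupAlgebra 𝓡) f = 0 := by
  have h := mkHom_rel (rel := relations 𝓡) (Or.inr ⟨f, hf, rfl⟩)
  have : ((mkHom (rel := relations 𝓡)).toAlgHom.comp (substE G)) =
      FreeAlgebra.lift ℂ (e : G → PartialGroupAlgebra 𝓡) := by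
    refine FreeAlgebra.hom_ext (funext fun g => ?_)
    simp only [Function.comp_apply, AlgHom.comp_apply, substE, FreeAlgebra.lift_ι_apply]
    exact map_mul (mkHom (rel := relations 𝓡)) _ _
  rw [← this]
  exact h

/-- If `[h]` is an isometry then `[g][h] = [gh]`. -/
theorem bracket_mul_of_isometry (g h : G) (hh : (e h⁻¹ : PartialGroupAlgebra 𝓡) = 1) :
    (bracket g * bracket h : PartialGroupAlgebra 𝓡) = bracket (g * h) := by
  have h1 : (bracket h⁻¹ * bracket h : PartialGroupAlgebra 𝓡) = 1 := by
    simpa [e] using hh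
  have h2 := congrArg (· * (bracket h : PartialGroupAlgebra 𝓡)) (bracket_mul (𝓡 := 𝓡) g h)
  simpa [mul_assoc, h1] using h2

/-- If `[g⁻¹]` is an isometry then `[g][h] = [gh]`. -/
theorem bracket_mul_of_coisometry (g h : G) (hg : (e g : PartialGroupAlgebra 𝓡) = 1) :
    (bracket g * bracket h : PartialGroupAlgebra 𝓡) = bracket (g * h) := by
  have h1 := bracket_mul_of_isometry (𝓡 := 𝓡) h⁻¹ g⁻¹ (by rwa [inv_inv])
  have h2 := congrArg star h1
  simpa [star_bracket] using h2

end PartialGroupAlgebra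

/-! ### The regular C*-algebra of an integral domain -/

/-- All quotients of `R` by nonzero principal ideals are finite. -/
class FinitePrincipalQuotients (R : Type*) [CommRing R] : Prop where
  finite (m : R) (hm : m ≠ 0) : Finite (R ⧸ Ideal.span {m})

instance {R : Type*} [CommRing R] [IsDomain R] [FinitePrincipalQuotients R] (m : R⁰) :
    Fintype (R ⧸ Ideal.span {(m : R)}) :=
  have := FinitePrincipalQuotients.finite (m : R) (nonZeroDivisors.coe_ne_zero m)
  Fintype.ofFinite _

namespace RegularCStarAlgebra

open FreeStarAlgebra

/-- The generators: `s m` for nonzero `m` and `u n` for arbitrary `n`. -/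
inductive Gen (R : Type*) [CommRing R] : Type _
  | s (m : R⁰)
  | u (n : R)

variable (R : Type*) [CommRing R] [IsDomain R] [FinitePrincipalQuotients R]

/-- The defining relations: the `s m` are isometries, the `u n` are unitaries, `s_m s_m' = s_{mm'}`,
`u^n u^n' = u^{n+n'}`, `s_m u^n = u^{mn} s_m`, and `∑ u^l s_m s_m^* u^{-l} = 1`, the sum being over
the residue classes modulo `m`. In the last relation, `c` is any system of representatives of the residue classes modulo `m`. -/
inductive Rel : FreeStarAlgebra (Gen R) → Prop
  | isometry (m : R⁰) : Rel (star (of (.s m)) * of (.s m) - 1)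
  | unitary_left (n : R) : Rel (star (of (.u n)) * of (.u n) - 1)
  | unitary_right (n : R) : Rel (of (.u n) * star (of (.u n)) - 1)
  | cl1 (m m' : R⁰) : Rel (of (.s m) * of (.s m') - of (.s (m * m')))
  | cl2 (n n' : R) : Rel (of (.u n) * of (.u n') - of (.u (n + n')))
  | cl3 (m : R⁰) (n : R) : Rel (of (.s m) * of (.u n) - of (.u (m * n)) * of (.s m))
  | cl4 (m : R⁰) (c : R ⧸ Ideal.span {(m : R)} → R) (hc : ∀ q, Ideal.Quotient.mk _ (c q) = q) :
      Rel (∑ q, of (.u (c q)) * of (.s m) * star (of (.s m)) * of (.u (-c q)) - 1)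

/-- The set of defining relations. -/
def relations : Set (FreeStarAlgebra (Gen R)) := {r | Rel R r}

instance : BoundedRelations (relations R) :=
  BoundedRelations.of_generators fun p hp x => by
    have key : star (of x) * of x - 1 ∈ relations R := by
      cases x with
      | s m => exact .isometry m
      | u n => exact .unitary_left n
    refine cstarSeminorm_le_one hp _ (le_antisymm ?_ (apply_nonneg _ _))
    have e : of x * star (of x) * of x - of x = of x * (star (of x) * of x - 1) := by
      noncomm_ring
    rw [e]
    exact (hp.1 _ _).trans (by rw [hp.2.2 _ key, mul_zero])

end RegularCStarAlgebra

/-- The regular C*-algebra `𝔄[R]` of an integral domain `R` with finite quotients. -/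
abbrev RegularCStarAlgebra (R : Type*) [CommRing R] [IsDomain R] [FinitePrincipalQuotients R] :
    Type _ :=
  UniversalCStarAlgebra (RegularCStarAlgebra.relations R)

namespace RegularCStarAlgebra

variable {R : Type*} [CommRing R] [IsDomain R] [FinitePrincipalQuotients R]

/-- The isometry `s_m`. -/
def s (m : R⁰) : RegularCStarAlgebra R := UniversalCStarAlgebra.gen (.s m)

/-- The unitary `u^n`. -/
def u (n : R) : RegularCStarAlgebra R := UniversalCStarAlgebra.gen (.u n)

end RegularCStarAlgebra

/-! ### The group `K ⋊ Kˣ` and its partial group algebra -/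

/-- The action of `Kˣ` on the additive group of `K` by multiplication. -/
def unitsAction (K : Type*) [Field K] : Kˣ →* MulAut (Multiplicative K) where
  toFun w :=
    { toFun := fun x => Multiplicative.ofAdd ((w : K) * x.toAdd)
      invFun := fun x => Multiplicative.ofAdd ((w⁻¹ : Kˣ) * x.toAdd)
      left_inv := fun x => by simp
      right_inv := fun x => by simp
      map_mul' := fun x y => by simp [mul_add] }
  map_one' := by ext; simp
  map_mul' w w' := by ext; simp [mul_assoc]

/-- The semidirect product `K ⋊ Kˣ` for the multiplication action of `Kˣ` on the additive group
of `K`. -/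
abbrev AffineGroup (K : Type*) [Field K] : Type _ :=
  Multiplicative K ⋊[unitsAction K] Kˣ

namespace AffineGroup

variable {K : Type*} [Field K]

/-- The element `(u, w)` of `K ⋊ Kˣ`. -/
def pair (u : K) (w : Kˣ) : AffineGroup K := ⟨Multiplicative.ofAdd u, w⟩

theorem pair_mul (u u' : K) (w w' : Kˣ) :
    pair u w * pair u' w' = pair (u + u' * w) (w * w') := by
  rw [mul_comm u']
  rfl

theorem pair_zero_one : pair (0 : K) 1 = 1 := rfl

theorem pair_inv (u : K) (w : Kˣ) : (pair u w)⁻¹ = pair (-u / w) w⁻¹ := by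
  rw [inv_eq_iff_mul_eq_one, pair_mul, ← pair_zero_one]
  congr 1 <;> simp

end AffineGroup

namespace RegularCStarAlgebra

open AffineGroup PartialGroupAlgebra

variable (R : Type*) [CommRing R] [IsDomain R] [FinitePrincipalQuotients R]
  (K : Type*) [Field K] [Algebra R K] [IsFractionRing R K]

/-- A nonzero element of `R`, as a unit of the field of fractions. -/
def toUnits (m : R⁰) : Kˣ :=
  Units.mk0 (algebraMap R K m) (IsFractionRing.to_map_ne_zero_of_mem_nonZeroDivisors m.2)

/-- The relations `𝓡 = 𝓡₁ ∪ 𝓡₂ ∪ 𝓡₃`, where the variable `g` stands for `e_g`: `e_{(n,1)} = 1`,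
`e_{(0,1/m)} = 1`, and `∑ e_{(n,m)} = 1`, the sum being over any system `c` of representatives `n`
of the residue classes modulo `m`. -/
inductive PartialRel : FreeAlgebra ℂ (AffineGroup K) → Prop
  | r1 (n : R) : PartialRel (FreeAlgebra.ι ℂ (pair (algebraMap R K n) 1) - 1)
  | r2 (m : R⁰) : PartialRel (FreeAlgebra.ι ℂ (pair 0 (toUnits R K m)⁻¹) - 1)
  | r3 (m : R⁰) (c : R ⧸ Ideal.span {(m : R)} → R) (hc : ∀ q, Ideal.Quotient.mk _ (c q) = q) :
      PartialRel (∑ q, FreeAlgebra.ι ℂ (pair (algebraMap R K (c q)) (toUnits R K m)) - 1)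

/-- The set of relations `𝓡`. -/
def partialRelations : Set (FreeAlgebra ℂ (AffineGroup K)) := {f | PartialRel R K f}

/-- The partial group algebra `C*_p(K ⋊ Kˣ, 𝓡)`. -/
abbrev AffinePartialGroupAlgebra : Type _ := PartialGroupAlgebra (partialRelations R K)

/-- The bracket `[u, w]` in `C*_p(K ⋊ Kˣ, 𝓡)`. -/
def br (u : K) (w : Kˣ) : AffinePartialGroupAlgebra R K := bracket (pair u w)

variable {R K}

theorem e_r1 (n : R) :
    (e (pair (algebraMap R K n) 1) : AffinePartialGroupAlgebra R K) = 1 := by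
  have h := lift_e (𝓡 := partialRelations R K) (PartialRel.r1 n)
  rwa [map_sub, map_one, FreeAlgebra.lift_ι_apply, sub_eq_zero] at h

theorem e_r2 (m : R⁰) :
    (e (pair 0 (toUnits R K m)⁻¹) : AffinePartialGroupAlgebra R K) = 1 := by
  have h := lift_e (𝓡 := partialRelations R K) (PartialRel.r2 m)
  rwa [map_sub, map_one, FreeAlgebra.lift_ι_apply, sub_eq_zero] at h

theorem e_r3 (m : R⁰) (c : R ⧸ Ideal.span {(m : R)} → R)
    (hc : ∀ q, Ideal.Quotient.mk _ (c q) = q) :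
    ∑ q, (e (pair (algebraMap R K (c q)) (toUnits R K m)) : AffinePartialGroupAlgebra R K) = 1 := by
  have h := lift_e (𝓡 := partialRelations R K) (PartialRel.r3 m c hc)
  rw [map_sub, map_one, map_sum, sub_eq_zero] at h
  simpa only [FreeAlgebra.lift_ι_apply] using h

/-- `[u, w][n, 1] = [u + n w, w]`. -/
theorem br_mul_br_one (u : K) (w : Kˣ) (n : R) :
    br R K u w * br R K (algebraMap R K n) 1 = br R K (u + algebraMap R K n * w) w := by
  rw [br, br, br, bracket_mul_of_isometry, pair_mul, mul_one]
  rw [pair_inv, inv_one, Units.val_one, div_one, ← map_neg]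
  exact e_r1 _

/-- `[n, 1][u, w] = [n + u, w]`. -/
theorem br_one_mul_br (u : K) (w : Kˣ) (n : R) :
    br R K (algebraMap R K n) 1 * br R K u w = br R K (algebraMap R K n + u) w := by
  rw [br, br, br, bracket_mul_of_coisometry _ _ (e_r1 n), pair_mul]
  simp

/-- `[u, w][0, m] = [u, w m]`. -/
theorem br_mul_br_zero (u : K) (w : Kˣ) (m : R⁰) :
    br R K u w * br R K 0 (toUnits R K m) = br R K u (w * toUnits R K m) := by
  rw [br, br, br, bracket_mul_of_isometry, pair_mul]
  · simp
  · rw [pair_inv, neg_zero, zero_div]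
    exact e_r2 m

theorem star_br (u : K) (w : Kˣ) : star (br R K u w) = br R K (-u / w) w⁻¹ := by
  rw [br, br, star_bracket, pair_inv]

theorem br_zero_one : br R K 0 1 = 1 := bracket_one

theorem star_br_mul_br (m : R⁰) :
    star (br R K 0 (toUnits R K m)) * br R K 0 (toUnits R K m) = 1 := by
  rw [star_br, br_mul_br_zero, neg_zero, zero_div, inv_mul_cancel, br_zero_one]

theorem star_br_one (n : R) :
    star (br R K (algebraMap R K n) 1) = br R K (algebraMap R K (-n)) 1 := by
  rw [star_br, inv_one, Units.val_one, div_one, map_neg]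

theorem br_mul_star (n : R) (m : R⁰) :
    br R K (algebraMap R K n) 1 * br R K 0 (toUnits R K m) * star (br R K 0 (toUnits R K m)) *
      br R K (algebraMap R K (-n)) 1 = e (pair (algebraMap R K n) (toUnits R K m)) := by
  rw [br_one_mul_br, add_zero, mul_assoc, star_br, br_mul_br_one, e, pair_inv, br, br]
  congr 3
  simp [div_eq_mul_inv]

variable (R K)

/-- The images of the generators under `Ψ`: `u^n ↦ [n, 1]` and `s_m ↦ [0, m]`. -/
def psiGen : Gen R → AffinePartialGroupAlgebra R K
  | .s m => br R K 0 (toUnits R K m)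
  | .u n => br R K (algebraMap R K n) 1

theorem psiGen_relations : ∀ r ∈ relations R, FreeStarAlgebra.eval (psiGen R K) r = 0 := by
  intro r hr
  cases hr with
  | isometry m =>
    simp only [map_sub, map_mul, map_star, map_one, FreeStarAlgebra.eval_of, psiGen, sub_eq_zero]
    exact star_br_mul_br m
  | unitary_left n =>
    simp only [map_sub, map_mul, map_star, map_one, FreeStarAlgebra.eval_of, psiGen, sub_eq_zero]
    rw [star_br_one, br_one_mul_br, ← map_add, neg_add_cancel, map_zero, br_zero_one]
  | unitary_right n =>
    simp only [map_sub, map_mul, map_star, map_one, FreeStarAlgebra.eval_of, psiGen, sub_eq_zero]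
    rw [star_br_one, br_one_mul_br, ← map_add, add_neg_cancel, map_zero, br_zero_one]
  | cl1 m m' =>
    simp only [map_sub, map_mul, FreeStarAlgebra.eval_of, psiGen, sub_eq_zero]
    rw [br_mul_br_zero]
    congr 1
    ext
    simp [toUnits]
  | cl2 n n' =>
    simp only [map_sub, map_mul, FreeStarAlgebra.eval_of, psiGen, sub_eq_zero]
    rw [br_one_mul_br, ← map_add]
  | cl3 m n =>
    simp only [map_sub, map_mul, FreeStarAlgebra.eval_of, psiGen, sub_eq_zero]
    rw [br_mul_br_one, ← map_mul, br_one_mul_br]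
    congr 1
    simp [toUnits, mul_comm]
  | cl4 m c hc =>
    simp only [map_sub, map_mul, map_star, map_sum, map_one, FreeStarAlgebra.eval_of, psiGen,
      sub_eq_zero]
    rw [← e_r3 (K := K) m c hc]
    exact Finset.sum_congr rfl fun q _ => br_mul_star (c q) m

/-- The `*`-homomorphism `Ψ : 𝔄[R] → C*_p(K ⋊ Kˣ, 𝓡)` with `Ψ(u^n) = [n, 1]` and
`Ψ(s_m) = [0, m]`. -/
def psi : RegularCStarAlgebra R →⋆ₐ[ℂ] AffinePartialGroupAlgebra R K :=
  UniversalCStarAlgebra.lift (psiGen R K) (psiGen_relations R K)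

theorem psi_u (n : R) : psi R K (u n) = br R K (algebraMap R K n) 1 :=
  UniversalCStarAlgebra.lift_gen _ _ _

theorem psi_s (m : R⁰) : psi R K (s m) = br R K 0 (toUnits R K m) :=
  UniversalCStarAlgebra.lift_gen _ _ _

end RegularCStarAlgebra

/-! ### Conditional expectations -/

/-- The C*-subalgebra (unital) generated by a set. -/
def cstarSubalgebra {A : Type*} [CStarAlgebra A] (S : Set A) : StarSubalgebra ℂ A :=
  (StarAlgebra.adjoin ℂ S).topologicalClosure

/-- `E` is a faithful conditional expectation of the C*-algebra `A` onto its C*-subalgebra `B`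
(regarded as a map into `A`): a positive contractive `B`-bimodule map that is a projection onto
`B`, and which vanishes on no nonzero positive element. -/
structure IsFaithfulConditionalExpectation {A : Type*} [CStarAlgebra A] (B : StarSubalgebra ℂ A)
    (E : A →ₗ[ℂ] A) : Prop where
  mem (a : A) : E a ∈ B
  apply_of_mem (b : A) (hb : b ∈ B) : E b = b
  map_mul_left (b a : A) (hb : b ∈ B) : E (b * a) = b * E a
  map_mul_right (a b : A) (hb : b ∈ B) : E (a * b) = E a * b
  positive (a : A) : ∃ c ∈ B, E (star a * a) = star c * c
  norm_le (a : A) : ‖E a‖ ≤ ‖a‖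
  faithful (a : A) (ha : E (star a * a) = 0) : a = 0

namespace RegularCStarAlgebra

open PartialGroupAlgebra

variable (R : Type*) [CommRing R] [IsDomain R] [FinitePrincipalQuotients R]

open Classical in
/-- `E` is the canonical conditional expectation of `C*_p(K ⋊ Kˣ, 𝓡)`: a faithful conditional
expectation onto `C*({e_g})` such that `E([g₁]⋯[g_k])` is `[g₁]⋯[g_k]` if `g₁⋯g_k` is the
identity and `0` otherwise. -/
structure IsCanonicalExpectation (K : Type*) [Field K] [Algebra R K] [IsFractionRing R K]
    (E : AffinePartialGroupAlgebra R K →ₗ[ℂ] AffinePartialGroupAlgebra R K) : Prop where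
  expectation : IsFaithfulConditionalExpectation (cstarSubalgebra (Set.range e)) E
  apply_prod (l : List (AffineGroup K)) :
    E (l.map bracket).prod = if l.prod = 1 then (l.map bracket).prod else 0

open Classical in
/-- `Θ` is the Cuntz-Li conditional expectation of `𝔄[R]`: a faithful conditional expectation with
`Θ(s_{m''}^* u^n s_m s_m^* u^{-n'} s_{m'}) = δ_{m',m''} δ_{n,n'} s_{m'}^* u^n s_m s_m^* u^{-n} s_{m'}`,
onto the C*-subalgebra generated by the elements on the right hand side. -/
structure IsCuntzLiExpectation (Θ : RegularCStarAlgebra R →ₗ[ℂ] RegularCStarAlgebra R) : Prop where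
  expectation : IsFaithfulConditionalExpectation (cstarSubalgebra
    {a | ∃ (m m' : R⁰) (n : R), a = star (s m') * u n * s m * star (s m) * u (-n) * s m'}) Θ
  apply_monomial (m m' m'' : R⁰) (n n' : R) :
    Θ (star (s m'') * u n * s m * star (s m) * u (-n') * s m') =
      if m' = m'' ∧ n = n' then star (s m') * u n * s m * star (s m) * u (-n) * s m' else 0

end RegularCStarAlgebra

end

/-!
Everything rests on one description of `Ψ` and on the amenability of `K ⋊ Kˣ`.

*Bijectivity.* The inverse `phi` of `Ψ` sends `[n / d, m / d]` to `s_d^* u^n s_m`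
(`IsFraction`, `phiGen`). That this is a partial representation comes down to the commutation of the
projections `u^n s_m s_m^* u^{-n}` (`commute_proj`): for fixed `m` they are indexed by the residue
classes modulo `m` and sum to `1`, hence are pairwise orthogonal, and each of them is a sum of such
projections for any multiple of `m`.

*The expectation.* For any group `G` and relations `𝓡`, write `A = C*_p(G, 𝓡)`. The map
`[g] ↦ [g] ⊗ g` is a `*`-homomorphism `δ` from `*`-polynomials to the algebraic group algebra `A[G]`
that kills the relations. The group algebra is a pre-Hilbert `A`-module for the inner product
`(y x^*)_1`, and the operator norm of right multiplications is a C*-norm on it. By the universal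
property, `a ↦ δ(a)` is therefore contractive, so the coefficient of `δ(a)` at `1` extends to a
contraction `E = expectation 𝓡` of `A`. It keeps the words of degree `1` and kills the others, which
makes it a bimodule map over the algebra generated by the `e_g`, and `E(a a^*) = ∑ a_g a_g^*` if
`δ(a) = ∑ a_g g`.

*Faithfulness.* If `E(a a^*) = 0`, then all the coefficients `(x δ(a) x^*)_1` vanish as well
(`norm_vectorCoeff_indicator_sq_le`). When `x` is the indicator function of a finite `F ⊆ G`, such a
coefficient multiplies a word of degree `g` by the number of `h ∈ F` with `h g ∈ F`. Hence, if `F`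
runs through Følner sets, the coefficients divided by the cardinality of `F` converge to `a`
(`exists_norm_vectorCoeff_sub_le`), and so `a = 0`. The group `K ⋊ Kˣ` has Følner sets because it is
a semidirect product of commutative groups (`AffineGroup.folnerCondition`).

*The Cuntz-Li expectation.* It is `Ψ⁻¹ ∘ E ∘ Ψ`, since `Ψ` turns the monomials
`s_{m''}^* u^n s_m s_m^* u^{-n'} s_{m'}` into words of degree `((n - n') / m'', m' / m'')`. Both
expectations are unique because words and monomials, respectively, span dense subspaces
(`dense_span_words`, `dense_span_monomials`).
-/

noncomputable section

/-! ### Følner sets -/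

open Classical in
/-- The right Følner condition, one of the equivalent forms of amenability of a discrete group:
some finite nonempty `F` is moved into itself, up to a proportion `ε`, by right multiplication with
each element of a given finite set `S`. -/
def FolnerCondition (G : Type*) [Group G] : Prop :=
  ∀ (S : Finset G) (ε : ℝ), 0 < ε → ∃ F : Finset G, F.Nonempty ∧
    ∀ g ∈ S, (1 - ε) * (F.card : ℝ) ≤ ((F.filter fun x => x * g ∈ F).card : ℝ)

/-- A sequence of polynomial growth does not grow by a factor `1 + ε` at every step. -/
theorem exists_succ_le_of_polynomial_growth (c : ℕ → ℝ) (k : ℕ) (h0 : 1 ≤ c 0)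
    (hc : ∀ n, c n ≤ ((n : ℝ) + 1) ^ k) (ε : ℝ) (hε : 0 < ε) :
    ∃ n, c (n + 1) ≤ (1 + ε) * c n := by
  by_contra! h
  have h1 : ∀ n, (1 + ε) ^ n ≤ c n := by
    intro n
    induction n with
    | zero => simpa using h0
    | succ n ih =>
      rw [pow_succ']
      exact (mul_le_mul_of_nonneg_left ih (by linarith)).trans (h n).le
  have h2 := tendsto_pow_const_div_const_pow_of_one_lt k (r := 1 + ε) (by linarith)
  have h3 : ∀ᶠ n : ℕ in Filter.atTop, (n : ℝ) ^ k / (1 + ε) ^ n < (1 + ε)⁻¹ :=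
    h2.eventually_lt_const (by positivity)
  obtain ⟨N, hN⟩ := Filter.eventually_atTop.1 h3
  have h4 := hN (N + 1) (by omega)
  rw [div_lt_iff₀ (by positivity), pow_succ, mul_comm ((1 + ε) ^ N), inv_mul_cancel_left₀
    (by positivity)] at h4
  have h5 := (h1 N).trans (hc N)
  push_cast at h4
  linarith

/-- Commutative groups are amenable: the products `∏ s ^ f s` over `s ∈ S` with `0 ≤ f s ≤ n` form
sets of polynomial growth in `n`, and each is moved into the next one by the elements of `S`. -/
theorem folnerCondition_of_comm (G : Type*) [CommGroup G] : FolnerCondition G := by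
  classical
  intro S ε hε
  let F : ℕ → Finset G := fun n =>
    (Fintype.piFinset fun _ : S => Finset.range (n + 1)).image fun f => ∏ s : S, (s : G) ^ f s
  have hF : ∀ n x, x ∈ F n ↔ ∃ f : S → ℕ, (∀ s, f s ≤ n) ∧ ∏ s : S, (s : G) ^ f s = x := by
    intro n x
    simp [F, Fintype.mem_piFinset]
  have hmono : ∀ n, F n ⊆ F (n + 1) := by
    intro n x hx
    obtain ⟨f, hf, rfl⟩ := (hF n x).1 hx
    exact (hF _ _).2 ⟨f, fun s => (hf s).trans n.le_succ, rfl⟩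
  have hmul : ∀ n, ∀ g ∈ S, ∀ x ∈ F n, x * g ∈ F (n + 1) := by
    intro n g hg x hx
    obtain ⟨f, hf, rfl⟩ := (hF n x).1 hx
    refine (hF _ _).2 ⟨fun s => f s + if s = ⟨g, hg⟩ then 1 else 0, fun s => ?_, ?_⟩
    · have := hf s
      dsimp only
      split_ifs <;> omega
    · simp only [pow_add, Finset.prod_mul_distrib, pow_ite, pow_one, pow_zero, Finset.prod_ite_eq',
        Finset.mem_univ, if_true]
  have hne : ∀ n, (F n).Nonempty := fun n =>
    ⟨1, (hF n 1).2 ⟨fun _ => 0, fun _ => n.zero_le, by simp⟩⟩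
  have hcard : ∀ n, ((F n).card : ℝ) ≤ ((n : ℝ) + 1) ^ S.card := by
    intro n
    have : (F n).card ≤ (n + 1) ^ S.card := Finset.card_image_le.trans (by simp)
    exact_mod_cast this
  obtain ⟨n, hn⟩ := exists_succ_le_of_polynomial_growth (fun n => ((F n).card : ℝ)) S.card
    (by exact_mod_cast (hne 0).card_pos) hcard ε hε
  refine ⟨F n, hne n, fun g hg => ?_⟩
  have h1 : ((F n).filter fun x => ¬ x * g ∈ F n).card ≤ (F (n + 1) \ F n).card := by
    refine Finset.card_le_card_of_injOn (· * g) (fun x hx => ?_) (mul_left_injective g).injOn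
    have hx' := Finset.mem_filter.1 hx
    exact Finset.mem_sdiff.2 ⟨hmul n g hg x hx'.1, hx'.2⟩
  have h2 := Finset.card_filter_add_card_filter_not (s := F n) (fun x => x * g ∈ F n)
  have h3 := Finset.card_sdiff_add_card_eq_card (hmono n)
  have h1' : (((F n).filter fun x => ¬ x * g ∈ F n).card : ℝ) ≤ ((F (n + 1) \ F n).card : ℝ) := by
    exact_mod_cast h1
  have h2' : (((F n).filter fun x => x * g ∈ F n).card : ℝ)
      + ((F n).filter fun x => ¬ x * g ∈ F n).card = (F n).card := by exact_mod_cast h2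
  have h3' : ((F (n + 1) \ F n).card : ℝ) + (F n).card = (F (n + 1)).card := by exact_mod_cast h3
  linarith

/-- A semidirect product of amenable groups is amenable. -/
theorem FolnerCondition.semidirectProduct {N H : Type*} [Group N] [Group H] {φ : H →* MulAut N}
    (hN : FolnerCondition N) (hH : FolnerCondition H) : FolnerCondition (N ⋊[φ] H) := by
  classical
  intro S ε hε
  obtain ⟨F₂, hF₂, h₂⟩ := hH (S.image fun g => g.right) (min (ε / 2) 1) (by positivity)
  -- `⟨x, y⟩ * g = ⟨x * φ y g.left, y * g.right⟩`, so `F₁` has to be almost invariant under all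
  -- the elements `φ y g.left` with `y ∈ F₂`.
  obtain ⟨F₁, hF₁, h₁⟩ := hN ((F₂ ×ˢ S).image fun p => φ p.1 p.2.left) (min (ε / 2) 1)
    (by positivity)
  set δ := min (ε / 2) 1
  have hδ : δ ≤ ε / 2 := min_le_left _ _
  have hδ1 : δ ≤ 1 := min_le_right _ _
  let ι : H × N ↪ N ⋊[φ] H := ⟨fun p => ⟨p.2, p.1⟩, fun p q h =>
    Prod.ext (congrArg SemidirectProduct.right h) (congrArg SemidirectProduct.left h)⟩
  have hmem : ∀ z, z ∈ (F₂ ×ˢ F₁).map ι ↔ z.right ∈ F₂ ∧ z.left ∈ F₁ := by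
    intro z
    simp only [Finset.mem_map, Finset.mem_product, Prod.exists]
    constructor
    · rintro ⟨a, b, h, rfl⟩
      exact h
    · intro h
      exact ⟨z.right, z.left, h, rfl⟩
  refine ⟨(F₂ ×ˢ F₁).map ι, (hF₂.product hF₁).map, fun g hg => ?_⟩
  have hsub : (((F₂.filter fun y => y * g.right ∈ F₂).sigma fun y =>
      F₁.filter fun x => x * φ y g.left ∈ F₁).card : ℝ) ≤
      ((((F₂ ×ˢ F₁).map ι).filter fun z => z * g ∈ (F₂ ×ˢ F₁).map ι).card : ℝ) := by
    have : ((F₂.filter fun y => y * g.right ∈ F₂).sigma fun y =>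
      F₁.filter fun x => x * φ y g.left ∈ F₁).card ≤
      (((F₂ ×ˢ F₁).map ι).filter fun z => z * g ∈ (F₂ ×ˢ F₁).map ι).card := by
      refine Finset.card_le_card_of_injOn (fun p => ι (p.1, p.2)) (fun p hp => ?_) ?_
      · simp only [Finset.mem_coe, Finset.mem_sigma, Finset.mem_filter] at hp
        simp only [Finset.mem_coe, Finset.mem_filter, hmem]
        exact ⟨⟨hp.1.1, hp.2.1⟩, hp.1.2, hp.2.2⟩
      · rintro ⟨a, b⟩ - ⟨c, d⟩ - h
        have := ι.injective h
        simpa using this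
    exact_mod_cast this
  refine le_trans ?_ (hsub.trans_eq (by congr!))
  rw [Finset.card_map, Finset.card_product, Finset.card_sigma]
  push_cast
  have key : ∀ y ∈ F₂.filter fun y => y * g.right ∈ F₂,
      (1 - δ) * (F₁.card : ℝ) ≤ ((F₁.filter fun x => x * φ y g.left ∈ F₁).card : ℝ) := by
    intro y hy
    exact h₁ _ (Finset.mem_image.2 ⟨(y, g),
      Finset.mem_product.2 ⟨(Finset.mem_filter.1 hy).1, hg⟩, rfl⟩)
  refine le_trans ?_ (Finset.sum_le_sum key)
  rw [Finset.sum_const, nsmul_eq_mul]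
  have h3 := h₂ g.right (Finset.mem_image_of_mem _ hg)
  have h4 : (0 : ℝ) ≤ F₁.card := by positivity
  have h5 : (0 : ℝ) ≤ F₂.card := by positivity
  calc (1 - ε) * ((F₂.card : ℝ) * F₁.card)
      ≤ (1 - δ) * (1 - δ) * ((F₂.card : ℝ) * F₁.card) := by
        refine mul_le_mul_of_nonneg_right ?_ (by positivity)
        nlinarith [sq_nonneg δ]
    _ = ((1 - δ) * F₂.card) * ((1 - δ) * F₁.card) := by ring
    _ ≤ _ := mul_le_mul_of_nonneg_right h3 (mul_nonneg (by linarith) h4)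

theorem AffineGroup.folnerCondition (K : Type*) [Field K] : FolnerCondition (AffineGroup K) :=
  (folnerCondition_of_comm (Multiplicative K)).semidirectProduct (folnerCondition_of_comm Kˣ)

/-! ### The C*-norm of the group algebra with coefficients in a C*-algebra -/

namespace MonoidAlgebra

variable {A G : Type*} [CStarAlgebra A] [Group G]

/-- The involution `(∑ a_g g)^* = ∑ a_g^* g⁻¹` of the group algebra. -/
instance : Star (MonoidAlgebra A G) where
  star x := ofCoeff ((x.coeff.mapRange star (star_zero A)).equivMapDomain (Equiv.inv G))

theorem coeff_star_apply (x : MonoidAlgebra A G) (g : G) :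
    (star x).coeff g = star (x.coeff g⁻¹) := by
  change ((x.coeff.mapRange star (star_zero A)).equivMapDomain (Equiv.inv G)) g = _
  simp

theorem star_single (g : G) (a : A) :
    star (single g a : MonoidAlgebra A G) = single g⁻¹ (star a) := by
  classical
  ext h
  rw [coeff_star_apply, coeff_single, coeff_single, Finsupp.single_apply, Finsupp.single_apply,
    inv_eq_iff_eq_inv (a := g)]
  split_ifs <;> simp

instance : StarAddMonoid (MonoidAlgebra A G) where
  star_involutive x := by
    ext g
    simp [coeff_star_apply]
  star_add x y := by
    ext g
    simp [coeff_star_apply]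

instance : StarRing (MonoidAlgebra A G) where
  star_mul x y := by
    induction x using induction_linear with
    | zero => simp
    | add x x' hx hx' => rw [add_mul, star_add, hx, hx', star_add, mul_add]
    | single g a =>
      induction y using induction_linear with
      | zero => simp
      | add y y' hy hy' => rw [mul_add, star_add, hy, hy', star_add, add_mul]
      | single h b => simp [single_mul_single, star_single]
  star_add := star_add

instance : StarModule ℂ (MonoidAlgebra A G) where
  star_smul c x := by
    ext g
    simp [coeff_star_apply]

/-- The group algebra as a pre-Hilbert module over its coefficient algebra, for the inner product
`⟪x, y⟫ = (y x^*)_1`. Scalars from `A` multiply from the left, so that right multiplications in the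
group algebra are module maps. -/
instance : Inner A (MonoidAlgebra A G) := ⟨fun x y => (y * star x).coeff 1⟩

theorem inner_def (x y : MonoidAlgebra A G) : inner A x y = (y * star x).coeff 1 := rfl

instance : Norm (MonoidAlgebra A G) := CStarModule.norm A

/-- Right multiplication by `b^*` is adjoint to right multiplication by `b`. -/
theorem inner_mul_left (x y b : MonoidAlgebra A G) :
    inner A (x * b) y = inner A x (y * star b) := by
  rw [inner_def, inner_def, star_mul, mul_assoc]

/-- Left translation by a group element preserves the inner product. -/
theorem inner_single_mul (g : G) (x y : MonoidAlgebra A G) :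
    inner A (single g 1 * x) (single g 1 * y) = inner A x y := by
  rw [inner_def, inner_def, star_mul, star_single, star_one, mul_assoc, ← mul_assoc y,
    coeff_single_mul_apply, coeff_mul_single_apply]
  simp

theorem inner_self_eq (x : MonoidAlgebra A G) :
    inner A x x = x.coeff.sum fun _ a => a * star a := by
  rw [inner_def, coeff_mul_apply_left]
  simp only [coeff_star_apply, mul_one, inv_inv]
  rfl

variable [PartialOrder A] [StarOrderedRing A]

instance : CStarModule A (MonoidAlgebra A G) where
  inner_add_right := by simp [inner_def, add_mul]
  inner_self_nonneg {x} := by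
    rw [inner_self_eq]
    exact Finset.sum_nonneg fun g _ => mul_star_self_nonneg _
  inner_self {x} := by
    refine ⟨fun h => ?_, fun h => by simp [h, inner_def]⟩
    rw [inner_self_eq, Finsupp.sum,
      Finset.sum_eq_zero_iff_of_nonneg fun g _ => mul_star_self_nonneg _] at h
    ext g
    by_contra hg
    exact hg (CStarRing.mul_star_self_eq_zero_iff _ |>.1 (h g (Finsupp.mem_support_iff.2 hg)))
  inner_op_smul_right {a x y} := by
    simp only [inner_def, smul_mul_assoc, coeff_smul_apply, smul_eq_mul]
  inner_smul_right_complex := by simp [inner_def]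
  star_inner x y := by
    simp only [inner_def]
    rw [← inv_one, ← coeff_star_apply]
    simp
  norm_eq_sqrt_norm_inner_self x := rfl

instance : NormedAddCommGroup (MonoidAlgebra A G) := CStarModule.normedAddCommGroup A

instance : NormedSpace ℂ (MonoidAlgebra A G) := .ofCore (CStarModule.normedSpaceCore A)

theorem norm_sq_eq_inner (x : MonoidAlgebra A G) : ‖x‖ ^ 2 = ‖(inner A x x : A)‖ :=
  CStarModule.norm_sq_eq A (E := MonoidAlgebra A G) (x := x)

theorem norm_sq_eq (x : MonoidAlgebra A G) : ‖x‖ ^ 2 = ‖(x * star x).coeff 1‖ := by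
  rw [norm_sq_eq_inner, inner_def]

theorem norm_one_le : ‖(1 : MonoidAlgebra A G)‖ ≤ 1 := by
  refine (sq_le_one_iff₀ (norm_nonneg _)).1 ?_
  rw [norm_sq_eq, star_one, mul_one, coeff_one_one]
  nontriviality A
  rw [CStarRing.norm_one]

theorem norm_inner_le (x y : MonoidAlgebra A G) : ‖(inner A x y : A)‖ ≤ ‖x‖ * ‖y‖ :=
  CStarModule.norm_inner_le (MonoidAlgebra A G)

theorem norm_single_mul (g : G) (x : MonoidAlgebra A G) : ‖single g 1 * x‖ = ‖x‖ := by
  rw [← sq_eq_sq₀ (norm_nonneg _) (norm_nonneg _), norm_sq_eq_inner, inner_single_mul,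
    ← norm_sq_eq_inner]

theorem norm_mul_single_le (x : MonoidAlgebra A G) (g : G) (a : A) :
    ‖x * single g a‖ ≤ ‖a‖ * ‖x‖ := by
  refine (sq_le_sq₀ (norm_nonneg _) (by positivity)).1 ?_
  have h : inner A (x * single g a) (x * single g a) ≤ ‖a * star a‖ • inner A x x := by
    rw [inner_mul_left, star_single, mul_assoc, single_mul_single, mul_inv_cancel, inner_self_eq,
      inner_def, mul_assoc, coeff_mul_apply_left, Finsupp.sum, Finsupp.sum, Finset.smul_sum]
    refine Finset.sum_le_sum fun h _ => ?_
    have e : x.coeff h * (single 1 (a * star a) * star x).coeff (h⁻¹ * 1) =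
        x.coeff h * (a * star a) * star (x.coeff h) := by
      simp [coeff_star_apply, mul_assoc]
    rw [e]
    exact CStarAlgebra.star_right_conjugate_le_norm_smul
  have h0 : (0 : A) ≤ inner A (x * single g a) (x * single g a) :=
    CStarModule.inner_self_nonneg (A := A) (E := MonoidAlgebra A G) (x := x * single g a)
  have h2 := CStarAlgebra.norm_le_norm_of_nonneg_of_le h0 h
  rwa [norm_smul, norm_norm, CStarRing.norm_self_mul_star, ← norm_sq_eq_inner,
    ← norm_sq_eq_inner, ← sq, ← mul_pow] at h2

/-- Right multiplications are bounded. -/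
theorem exists_norm_mul_le (b : MonoidAlgebra A G) : ∃ C, ∀ x, ‖x * b‖ ≤ C * ‖x‖ := by
  induction b using induction_linear with
  | zero => exact ⟨0, by simp⟩
  | add b c hb hc =>
    obtain ⟨C, hC⟩ := hb
    obtain ⟨D, hD⟩ := hc
    refine ⟨C + D, fun x => ?_⟩
    rw [mul_add, add_mul]
    exact (norm_add_le _ _).trans (add_le_add (hC x) (hD x))
  | single g a => exact ⟨‖a‖, fun x => norm_mul_single_le x g a⟩

/-- Right multiplication by `b`, as a bounded operator. -/
def mulRightCLM : MonoidAlgebra A G →ₗ[ℂ] MonoidAlgebra A G →L[ℂ] MonoidAlgebra A G where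
  toFun b := (LinearMap.mulRight ℂ b).mkContinuousOfExistsBound (exists_norm_mul_le b)
  map_add' b c := by
    ext1 x
    exact mul_add x b c
  map_smul' c b := by
    ext1 x
    exact mul_smul_comm c x b

theorem mulRightCLM_apply (b x : MonoidAlgebra A G) : mulRightCLM b x = x * b := rfl

theorem norm_mulRightCLM_mul_le (b c : MonoidAlgebra A G) :
    ‖mulRightCLM (b * c)‖ ≤ ‖mulRightCLM b‖ * ‖mulRightCLM c‖ := by
  have : mulRightCLM (b * c) = mulRightCLM c ∘L mulRightCLM b := by
    ext1 x
    simp [mulRightCLM_apply, mul_assoc]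
  rw [this, mul_comm]
  exact ContinuousLinearMap.opNorm_comp_le _ _

theorem norm_mulRightCLM_star_sq_le (b : MonoidAlgebra A G) :
    ‖mulRightCLM (star b)‖ ^ 2 ≤ ‖mulRightCLM (star b * b)‖ := by
  refine (Real.le_sqrt (norm_nonneg _) (norm_nonneg _)).1 ?_
  refine ContinuousLinearMap.opNorm_le_bound _ (Real.sqrt_nonneg _) fun x => ?_
  refine (sq_le_sq₀ (norm_nonneg _) (by positivity)).1 ?_
  rw [mul_pow, Real.sq_sqrt (norm_nonneg _), mulRightCLM_apply, norm_sq_eq_inner,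
    inner_mul_left, star_star, mul_assoc]
  refine (norm_inner_le _ _).trans ?_
  have := (mulRightCLM (star b * b)).le_opNorm x
  rw [mulRightCLM_apply] at this
  nlinarith [norm_nonneg x]

theorem norm_mulRightCLM_star_mul_self (b : MonoidAlgebra A G) :
    ‖mulRightCLM (star b * b)‖ = ‖mulRightCLM b‖ ^ 2 := by
  have key : ∀ b : MonoidAlgebra A G, ‖mulRightCLM (star b)‖ ≤ ‖mulRightCLM b‖ := by
    intro b
    have h1 := norm_mulRightCLM_star_sq_le b
    have h2 := norm_mulRightCLM_mul_le (star b) b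
    nlinarith [norm_nonneg (mulRightCLM (star b)), norm_nonneg (mulRightCLM b)]
  have h3 : ‖mulRightCLM (star b)‖ = ‖mulRightCLM b‖ :=
    le_antisymm (key b) (by simpa using key (star b))
  refine le_antisymm ?_ (h3 ▸ norm_mulRightCLM_star_sq_le b)
  rw [sq]
  exact (norm_mulRightCLM_mul_le _ _).trans_eq (by rw [h3])

end MonoidAlgebra

/-! ### Density of left invariant subspaces -/

namespace UniversalCStarAlgebra

variable {X : Type*} {rel : Set (FreeStarAlgebra X)} [BoundedRelations rel]

theorem denseRange_mkHom :
    DenseRange (mkHom : FreeStarAlgebra X →⋆ₐ[ℂ] UniversalCStarAlgebra rel) :=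
  UniformSpace.Completion.denseRange_coe (α := Pre rel)

/-- A subspace that contains `1` and is invariant under left multiplication by the generators and
their adjoints contains the dense image of the free `*`-algebra. -/
theorem dense_of_gen_mul_mem (M : Submodule ℂ (UniversalCStarAlgebra rel)) (h1 : 1 ∈ M)
    (hg : ∀ x, ∀ y ∈ M, gen x * y ∈ M) (hs : ∀ x, ∀ y ∈ M, star (gen x) * y ∈ M) :
    Dense (M : Set (UniversalCStarAlgebra rel)) := by
  have key : ∀ a : FreeStarAlgebra X, ∀ y ∈ M, mkHom a * y ∈ M := by
    intro a
    induction a using FreeStarAlgebra.induct with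
    | scalar c =>
      intro y hy
      rw [AlgHomClass.commutes, ← Algebra.smul_def]
      exact M.smul_mem c hy
    | of x => exact hg x
    | ofStar x =>
      rw [← FreeStarAlgebra.star_of, map_star]
      exact hs x
    | mul a b ha hb =>
      intro y hy
      rw [map_mul, mul_assoc]
      exact ha _ (hb y hy)
    | add a b ha hb =>
      intro y hy
      rw [map_add, add_mul]
      exact M.add_mem (ha y hy) (hb y hy)
  refine denseRange_mkHom.mono ?_
  rintro _ ⟨a, rfl⟩
  simpa using key a 1 h1

end UniversalCStarAlgebra

/-- Contractive linear maps that agree on a set with dense span are equal. -/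
theorem LinearMap.eq_of_eqOn_dense_span {A : Type*} [NormedAddCommGroup A] [NormedSpace ℂ A]
    {f g : A →ₗ[ℂ] A} (hf : ∀ a, ‖f a‖ ≤ ‖a‖) (hg : ∀ a, ‖g a‖ ≤ ‖a‖) {S : Set A}
    (hS : Dense (Submodule.span ℂ S : Set A)) (h : Set.EqOn f g S) : f = g := by
  have hf' : Continuous f := AddMonoidHomClass.continuous_of_bound f 1 (by simpa using hf)
  have hg' : Continuous g := AddMonoidHomClass.continuous_of_bound g 1 (by simpa using hg)
  exact DFunLike.coe_injective (Continuous.ext_on hS hf' hg' (LinearMap.eqOn_span' h))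

/-- The positive square root of a positive element lies in every C*-subalgebra containing it. -/
theorem StarSubalgebra.exists_star_mul_self_eq {A : Type*} [CStarAlgebra A]
    [PartialOrder A] [StarOrderedRing A] (B : StarSubalgebra ℂ A)
    (hB : IsClosed (B : Set A)) {a : A} (ha : a ∈ B) (h0 : 0 ≤ a) :
    ∃ c ∈ B, a = star c * c := by
  refine ⟨CFC.sqrt a, ?_, ?_⟩
  · rw [CFC.sqrt_eq_real_sqrt a, cfcₙ_eq_cfc]
    exact cfc_mem (𝕜' := ℂ) (hs := hB) Real.sqrt ha
  · rw [(CFC.sqrt_nonneg a).isSelfAdjoint.star_eq, CFC.sqrt_mul_sqrt_self a]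

/-! ### The coaction of `G` on a partial group algebra -/

namespace PartialGroupAlgebra

open FreeStarAlgebra UniversalCStarAlgebra MonoidAlgebra

-- The order enters the norm of `MonoidAlgebra A G` only through the proofs of its properties.
attribute [local instance] CStarAlgebra.spectralOrder CStarAlgebra.spectralOrderedRing

variable {G : Type*} [Group G] (𝓡 : Set (FreeAlgebra ℂ G))

/-- The coaction `[g] ↦ [g] ⊗ g` on `*`-polynomials. -/
def coaction : FreeStarAlgebra G →⋆ₐ[ℂ] MonoidAlgebra (PartialGroupAlgebra 𝓡) G :=
  eval fun g => single g (bracket g)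

theorem coaction_of (g : G) : coaction 𝓡 (of g) = single g (bracket g) := eval_of _ _

theorem coaction_substE (f : FreeAlgebra ℂ G) :
    coaction 𝓡 (substE G f) = single 1 (FreeAlgebra.lift ℂ e f) := by
  have : (coaction 𝓡).toAlgHom.comp (substE G) =
      (singleOneAlgHom : PartialGroupAlgebra 𝓡 →ₐ[ℂ] _).comp (FreeAlgebra.lift ℂ e) := by
    refine FreeAlgebra.hom_ext (funext fun g => ?_)
    simp only [Function.comp_apply, AlgHom.comp_apply, substE, FreeAlgebra.lift_ι_apply]
    refine (map_mul (coaction 𝓡) _ _).trans ?_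
    rw [coaction_of, coaction_of, single_mul_single, mul_inv_cancel]
    rfl
  exact DFunLike.congr_fun this f

theorem coaction_relations {r : FreeStarAlgebra G} (hr : r ∈ relations 𝓡) :
    coaction 𝓡 r = 0 := by
  rcases hr with hr | ⟨f, hf, rfl⟩
  · cases hr with
    | one => rw [map_sub, map_one, coaction_of, bracket_one, one_def, sub_self]
    | inv g =>
      rw [map_sub, map_star, coaction_of, coaction_of, MonoidAlgebra.star_single, star_bracket,
        sub_self]
    | mul g h =>
      simp only [map_sub, map_mul, coaction_of, single_mul_single]
      rw [bracket_mul, sub_self]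
  · rw [coaction_substE, lift_e hf, single_zero]

/-- The norm of the operator of right multiplication by `coaction 𝓡 a`. -/
def reducedSeminorm : Seminorm ℂ (FreeStarAlgebra G) :=
  (normSeminorm ℂ (MonoidAlgebra (PartialGroupAlgebra 𝓡) G →L[ℂ]
    MonoidAlgebra (PartialGroupAlgebra 𝓡) G)).comp
    (mulRightCLM.comp (coaction 𝓡).toAlgHom.toLinearMap)

theorem reducedSeminorm_apply (a : FreeStarAlgebra G) :
    reducedSeminorm 𝓡 a = ‖mulRightCLM (coaction 𝓡 a)‖ := rfl

theorem reducedSeminorm_mem : reducedSeminorm 𝓡 ∈ cstarSeminorms (relations 𝓡) := by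
  refine ⟨fun a b => ?_, fun a => ?_, fun r hr => ?_⟩
  · simp only [reducedSeminorm_apply, map_mul]
    exact norm_mulRightCLM_mul_le _ _
  · simp only [reducedSeminorm_apply, map_mul, map_star]
    exact norm_mulRightCLM_star_mul_self _
  · rw [reducedSeminorm_apply, coaction_relations 𝓡 hr, map_zero, norm_zero]

theorem norm_mul_coaction_le (x : MonoidAlgebra (PartialGroupAlgebra 𝓡) G)
    (a : FreeStarAlgebra G) :
    ‖x * coaction 𝓡 a‖ ≤ ‖(mkHom a : PartialGroupAlgebra 𝓡)‖ * ‖x‖ := by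
  rw [← mulRightCLM_apply]
  refine (ContinuousLinearMap.le_opNorm _ _).trans (mul_le_mul_of_nonneg_right ?_ (norm_nonneg _))
  exact (le_maxSeminorm (reducedSeminorm_mem 𝓡) a).trans_eq (norm_mk a).symm

variable {𝓡}

/-- `a ↦ (x δ(a) x^*)_1` on `*`-polynomials, where `δ` is the coaction. -/
def vectorCoeffPre (x : MonoidAlgebra (PartialGroupAlgebra 𝓡) G) :
    FreeStarAlgebra G →ₗ[ℂ] PartialGroupAlgebra 𝓡 where
  toFun a := inner _ x (x * coaction 𝓡 a)
  map_add' a b := by rw [map_add, mul_add, inner_def, add_mul]; rfl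
  map_smul' c a := by
    rw [map_smul, mul_smul_comm, inner_def, smul_mul_assoc]; rfl

theorem norm_vectorCoeffPre_le (x : MonoidAlgebra (PartialGroupAlgebra 𝓡) G)
    (a : FreeStarAlgebra G) :
    ‖vectorCoeffPre x a‖ ≤ ‖x‖ ^ 2 * ‖(mkHom a : PartialGroupAlgebra 𝓡)‖ := by
  refine (norm_inner_le _ _).trans ?_
  have := norm_mul_coaction_le 𝓡 x a
  nlinarith [norm_nonneg x]

/-- The continuous extension of `a ↦ (x δ(a) x^*)_1` to the partial group algebra. -/
def vectorCoeff (x : MonoidAlgebra (PartialGroupAlgebra 𝓡) G) :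
    PartialGroupAlgebra 𝓡 →L[ℂ] PartialGroupAlgebra 𝓡 :=
  (vectorCoeffPre x).extendOfNorm (mkHom : _ →⋆ₐ[ℂ] PartialGroupAlgebra 𝓡).toAlgHom.toLinearMap

theorem vectorCoeff_mkHom (x : MonoidAlgebra (PartialGroupAlgebra 𝓡) G)
    (a : FreeStarAlgebra G) :
    vectorCoeff x (mkHom a) = inner _ x (x * coaction 𝓡 a) :=
  LinearMap.extendOfNorm_eq denseRange_mkHom ⟨_, norm_vectorCoeffPre_le x⟩ a

theorem norm_vectorCoeff_le (x : MonoidAlgebra (PartialGroupAlgebra 𝓡) G)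
    (a : PartialGroupAlgebra 𝓡) : ‖vectorCoeff x a‖ ≤ ‖x‖ ^ 2 * ‖a‖ :=
  LinearMap.norm_extendOfNorm_apply_le denseRange_mkHom _ (norm_vectorCoeffPre_le x) a

theorem mkHom_word (l : List G) :
    (mkHom (l.map of).prod : PartialGroupAlgebra 𝓡) = (l.map bracket).prod := by
  rw [map_list_prod, List.map_map]
  rfl

theorem coaction_word (l : List G) :
    coaction 𝓡 (l.map of).prod = single l.prod (l.map bracket).prod := by
  induction l with
  | nil => simp [one_def]
  | cons g l ih => simp [ih, coaction_of, single_mul_single]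

variable (𝓡) in
theorem dense_span_words : Dense (Submodule.span ℂ (Set.range fun l : List G =>
    ((l.map bracket).prod : PartialGroupAlgebra 𝓡)) : Set (PartialGroupAlgebra 𝓡)) := by
  have key : ∀ g, ∀ y ∈ Submodule.span ℂ
      (Set.range fun l : List G => ((l.map bracket).prod : PartialGroupAlgebra 𝓡)),
      bracket g * y ∈ Submodule.span ℂ (Set.range fun l : List G => (l.map bracket).prod) := by
    intro g y hy
    induction hy using Submodule.span_induction with
    | mem y hy =>
      obtain ⟨l, rfl⟩ := hy
      exact Submodule.subset_span ⟨g :: l, by simp⟩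
    | zero => simp
    | add y z _ _ hy hz => rw [mul_add]; exact Submodule.add_mem _ hy hz
    | smul c y _ hy => rw [mul_smul_comm]; exact Submodule.smul_mem _ c hy
  refine dense_of_gen_mul_mem _ (Submodule.subset_span ⟨[], by simp⟩) key fun g y hy => ?_
  have := key g⁻¹ y hy
  rwa [← star_bracket] at this

/-! ### The expectation onto the diagonal -/

variable (𝓡) in
/-- The expectation that takes `a` to the coefficient at the identity of its image under the
coaction. -/
def expectation : PartialGroupAlgebra 𝓡 →L[ℂ] PartialGroupAlgebra 𝓡 := vectorCoeff 1

theorem expectation_mkHom (a : FreeStarAlgebra G) :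
    expectation 𝓡 (mkHom a) = (coaction 𝓡 a).coeff 1 := by
  rw [expectation, vectorCoeff_mkHom, inner_def, one_mul, star_one, mul_one]

open Classical in
theorem expectation_word (l : List G) :
    expectation 𝓡 (l.map bracket).prod = if l.prod = 1 then (l.map bracket).prod else 0 := by
  rw [← mkHom_word, expectation_mkHom, coaction_word, coeff_single, Finsupp.single_apply,
    mkHom_word]

theorem norm_expectation_le (a : PartialGroupAlgebra 𝓡) : ‖expectation 𝓡 a‖ ≤ ‖a‖ := by
  refine (norm_vectorCoeff_le 1 a).trans (mul_le_of_le_one_left (norm_nonneg _) ?_)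
  exact pow_le_one₀ (norm_nonneg _) norm_one_le

theorem expectation_star_mul_self_nonneg (a : PartialGroupAlgebra 𝓡) :
    0 ≤ expectation 𝓡 (star a * a) := by
  induction a using mk_induct with
  | hc => 
    exact CStarAlgebra.isClosed_nonneg.preimage
      ((expectation 𝓡).continuous.comp (continuous_star.mul continuous_id))
  | h a =>
    have h : expectation 𝓡 (star (mk a) * mk a) =
        inner _ (star (coaction 𝓡 a)) (star (coaction 𝓡 a)) := by
      rw [star_mk, ← mk_mul, inner_def, star_star, ← map_star, ← map_mul]
      exact expectation_mkHom _
    rw [h]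
    exact CStarModule.inner_self_nonneg (A := PartialGroupAlgebra 𝓡)
      (E := MonoidAlgebra (PartialGroupAlgebra 𝓡) G) (x := star (coaction 𝓡 a))

theorem expectation_star (a : PartialGroupAlgebra 𝓡) :
    expectation 𝓡 (star a) = star (expectation 𝓡 a) := by
  induction a using mk_induct with
  | hc => exact isClosed_eq (by fun_prop) (by fun_prop)
  | h a =>
    change expectation 𝓡 (star (mkHom a)) = star (expectation 𝓡 (mkHom a))
    rw [← map_star, expectation_mkHom, expectation_mkHom, map_star, coeff_star_apply, inv_one]

theorem bracket_mul_inv_mul (g : G) :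
    (bracket g * bracket g⁻¹ * bracket g : PartialGroupAlgebra 𝓡) = bracket g := by
  have := bracket_mul (𝓡 := 𝓡) g g⁻¹
  rwa [inv_inv, mul_inv_cancel, bracket_one, one_mul] at this

theorem bracket_inv_mul (g h : G) :
    (bracket g⁻¹ * bracket g * bracket h : PartialGroupAlgebra 𝓡) =
      bracket g⁻¹ * bracket (g * h) := by
  have := congrArg star (bracket_mul (𝓡 := 𝓡) h⁻¹ g⁻¹)
  simpa [star_bracket, mul_assoc] using this

/-- `[g][h] = [g][g⁻¹][g][h] = [g][g⁻¹][gh]`. -/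
theorem bracket_mul_bracket (g h : G) :
    (bracket g * bracket h : PartialGroupAlgebra 𝓡) = e g * bracket (g * h) := by
  rw [e, mul_assoc, ← bracket_inv_mul, ← mul_assoc, ← mul_assoc, bracket_mul_inv_mul]

theorem star_e (g : G) : star (e g : PartialGroupAlgebra 𝓡) = e g := by
  rw [e, star_mul, star_bracket, star_bracket, inv_inv]

theorem e_mem (g : G) : e g ∈ cstarSubalgebra (Set.range (e : G → PartialGroupAlgebra 𝓡)) :=
  StarSubalgebra.le_topologicalClosure _ (StarAlgebra.subset_adjoin ℂ _ ⟨g, rfl⟩)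

/-- The word `[g₁]⋯[g_k]` is `e_{g₁} e_{g₁g₂} ⋯ [g₁⋯g_k]`. -/
theorem exists_word_eq (l : List G) :
    ∃ d ∈ cstarSubalgebra (Set.range (e : G → PartialGroupAlgebra 𝓡)),
      (l.map bracket).prod = d * bracket l.prod := by
  induction l using List.reverseRecOn with
  | nil => exact ⟨1, one_mem _, by simp [bracket_one]⟩
  | append_singleton l g ih =>
    obtain ⟨d, hd, h⟩ := ih
    refine ⟨d * e l.prod, mul_mem hd (e_mem _), ?_⟩
    rw [List.map_append, List.prod_append, h]
    simp [mul_assoc, bracket_mul_bracket]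

theorem isClosed_cstarSubalgebra {A : Type*} [CStarAlgebra A] (S : Set A) :
    IsClosed (cstarSubalgebra S : Set A) :=
  StarSubalgebra.isClosed_topologicalClosure _

theorem expectation_mem (a : PartialGroupAlgebra 𝓡) :
    expectation 𝓡 a ∈ cstarSubalgebra (Set.range (e : G → PartialGroupAlgebra 𝓡)) := by
  have hcl : IsClosed {a | expectation 𝓡 a ∈
      cstarSubalgebra (Set.range (e : G → PartialGroupAlgebra 𝓡))} :=
    (isClosed_cstarSubalgebra _).preimage (expectation 𝓡).continuous
  refine hcl.closure_subset_iff.2 ?_ (dense_span_words 𝓡 a)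
  intro a ha
  induction ha using Submodule.span_induction with
  | mem a ha =>
    obtain ⟨l, rfl⟩ := ha
    classical
    rw [Set.mem_ofPred_eq, expectation_word]
    split_ifs with hl
    · obtain ⟨d, hd, h⟩ := exists_word_eq (𝓡 := 𝓡) l
      rwa [h, hl, bracket_one, mul_one]
    · exact zero_mem _
  | zero => simp
  | add a b _ _ ha hb =>
    rw [Set.mem_ofPred_eq, map_add]
    exact add_mem ha hb
  | smul c a _ ha =>
    rw [Set.mem_ofPred_eq, map_smul]
    exact SMulMemClass.smul_mem c ha

/-- Multiplication by `e_g` does not change the degree of a word. -/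
theorem expectation_e_mul (g : G) (a : PartialGroupAlgebra 𝓡) :
    expectation 𝓡 (e g * a) = e g * expectation 𝓡 a := by
  have hcl : IsClosed {a | expectation 𝓡 (e g * a) = e g * expectation 𝓡 a} :=
    isClosed_eq (by fun_prop) (by fun_prop)
  refine hcl.closure_subset_iff.2 ?_ (dense_span_words 𝓡 a)
  intro a ha
  induction ha using Submodule.span_induction with
  | mem a ha =>
    obtain ⟨l, rfl⟩ := ha
    classical
    have h1 := expectation_word (𝓡 := 𝓡) (g :: g⁻¹ :: l)
    simp only [List.map_cons, List.prod_cons, ← mul_assoc, mul_inv_cancel, one_mul] at h1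
    change expectation 𝓡 (e g * _) = e g * expectation 𝓡 _
    rw [expectation_word, e, h1]
    split_ifs <;> simp
  | zero => simp
  | add a b _ _ ha hb =>
    simp only [Set.mem_ofPred_eq, mul_add, map_add] at ha hb ⊢
    rw [ha, hb]
  | smul c a _ ha =>
    simp only [Set.mem_ofPred_eq, mul_smul_comm, map_smul] at ha ⊢
    rw [ha]

theorem expectation_bimodule (b : PartialGroupAlgebra 𝓡)
    (hb : b ∈ cstarSubalgebra (Set.range (e : G → PartialGroupAlgebra 𝓡))) :
    (∀ a, expectation 𝓡 (b * a) = b * expectation 𝓡 a) ∧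
      ∀ a, expectation 𝓡 (a * b) = expectation 𝓡 a * b := by
  have hcl : IsClosed {b | (∀ a, expectation 𝓡 (b * a) = b * expectation 𝓡 a) ∧
      ∀ a, expectation 𝓡 (a * b) = expectation 𝓡 a * b} := by
    simp only [Set.ofPred_and, Set.ofPred_forall]
    exact (isClosed_iInter fun a => isClosed_eq (by fun_prop) (by fun_prop)).inter
      (isClosed_iInter fun a => isClosed_eq (by fun_prop) (by fun_prop))
  refine hcl.closure_subset_iff.2 ?_ hb
  intro b hb
  -- Taking adjoints exchanges left and right multiplication.
  have hstar : ∀ b : PartialGroupAlgebra 𝓡, (∀ a, expectation 𝓡 (b * a) = b * expectation 𝓡 a) →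
      ∀ a, expectation 𝓡 (a * star b) = expectation 𝓡 a * star b := by
    intro b h a
    have := congrArg star (h (star a))
    simpa [← expectation_star] using this
  have hstar' : ∀ b : PartialGroupAlgebra 𝓡, (∀ a, expectation 𝓡 (a * b) = expectation 𝓡 a * b) →
      ∀ a, expectation 𝓡 (star b * a) = star b * expectation 𝓡 a := by
    intro b h a
    have := congrArg star (h (star a))
    simpa [← expectation_star] using this
  induction hb using StarAlgebra.adjoin_induction with
  | mem b hb =>
    obtain ⟨g, rfl⟩ := hb
    refine ⟨expectation_e_mul g, ?_⟩
    have := hstar _ (expectation_e_mul (𝓡 := 𝓡) g)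
    rwa [star_e] at this
  | algebraMap c =>
    refine ⟨fun a => ?_, fun a => ?_⟩
    · rw [← Algebra.smul_def, ← Algebra.smul_def, map_smul]
    · rw [← Algebra.commutes, ← Algebra.smul_def, ← Algebra.commutes, ← Algebra.smul_def, map_smul]
  | add b c _ _ hb hc =>
    refine ⟨fun a => ?_, fun a => ?_⟩
    · rw [add_mul, map_add, hb.1, hc.1, add_mul]
    · rw [mul_add, map_add, hb.2, hc.2, mul_add]
  | mul b c _ _ hb hc =>
    refine ⟨fun a => ?_, fun a => ?_⟩
    · rw [mul_assoc, hb.1, hc.1, mul_assoc]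
    · rw [← mul_assoc, hc.2, hb.2, mul_assoc]
  | star b _ hb => exact ⟨hstar' b hb.2, hstar b hb.1⟩

/-! ### Faithfulness for amenable groups -/

/-- The indicator function of a finite set, in the group algebra. -/
def indicator (𝓡 : Set (FreeAlgebra ℂ G)) (F : Finset G) :
    MonoidAlgebra (PartialGroupAlgebra 𝓡) G := ∑ g ∈ F, single g 1

open Classical in
theorem vectorCoeff_indicator_word (F : Finset G) (l : List G) :
    vectorCoeff (indicator 𝓡 F) (l.map bracket).prod =
      ((F.filter fun x => x * l.prod ∈ F).card : ℂ) • (l.map bracket).prod := by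
  rw [← mkHom_word, vectorCoeff_mkHom, coaction_word, mkHom_word, inner_def, indicator, star_sum,
    Finset.sum_mul, Finset.sum_mul, coeff_sum, Finset.sum_apply']
  have : ∀ x ∈ F, (single x 1 * single l.prod (l.map bracket).prod *
      ∑ y ∈ F, star (single y (1 : PartialGroupAlgebra 𝓡))).coeff 1 =
      if x * l.prod ∈ F then (l.map bracket).prod else 0 := by
    intro x hx
    rw [Finset.mul_sum, coeff_sum, Finset.sum_apply']
    simp [MonoidAlgebra.star_single, single_mul_single, Finsupp.single_apply, mul_inv_eq_one]
  rw [Finset.sum_congr rfl this, ← Finset.sum_filter, Finset.sum_const, Nat.cast_smul_eq_nsmul]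

theorem norm_indicator_sq_le (F : Finset G) : ‖indicator 𝓡 F‖ ^ 2 ≤ F.card := by
  classical
  have h := vectorCoeff_indicator_word (𝓡 := 𝓡) F []
  have h1 : (1 : PartialGroupAlgebra 𝓡) = mkHom 1 := (map_one _).symm
  simp only [List.map_nil, List.prod_nil, mul_one, Finset.filter_mem_eq_inter,
    Finset.inter_self] at h
  rw [h1, vectorCoeff_mkHom, map_one, mul_one, map_one] at h
  rw [norm_sq_eq_inner, h, norm_smul]
  nontriviality (PartialGroupAlgebra 𝓡)
  simp

theorem norm_indicator_mul_le (F : Finset G) (x : MonoidAlgebra (PartialGroupAlgebra 𝓡) G) :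
    ‖indicator 𝓡 F * x‖ ≤ F.card * ‖x‖ := by
  rw [indicator, Finset.sum_mul]
  refine (norm_sum_le _ _).trans ?_
  simp [norm_single_mul]

/-- The vector coefficients are dominated by the expectation. -/
theorem norm_vectorCoeff_indicator_sq_le (F : Finset G) (a : PartialGroupAlgebra 𝓡) :
    ‖vectorCoeff (indicator 𝓡 F) a‖ ^ 2 ≤
      (‖indicator 𝓡 F‖ * F.card) ^ 2 * ‖expectation 𝓡 (a * star a)‖ := by
  induction a using mk_induct with
  | hc => exact isClosed_le (by fun_prop) (by fun_prop)
  | h a =>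
    have h : expectation 𝓡 (mk a * star (mk a)) =
        inner _ (coaction 𝓡 a) (coaction 𝓡 a) := by
      rw [star_mk, ← mk_mul, inner_def, ← map_star, ← map_mul]
      exact expectation_mkHom _
    rw [h, ← norm_sq_eq_inner, ← mul_pow]
    refine pow_le_pow_left₀ (norm_nonneg _) ?_ 2
    change ‖vectorCoeff _ (mkHom a)‖ ≤ _
    rw [vectorCoeff_mkHom, mul_assoc]
    exact (norm_inner_le _ _).trans
      (mul_le_mul_of_nonneg_left (norm_indicator_mul_le _ _) (norm_nonneg _))

/-- For amenable `G`, the normalized vector coefficients of Følner sets approximate the identity. -/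
theorem exists_norm_vectorCoeff_sub_le (hG : FolnerCondition G) (a : PartialGroupAlgebra 𝓡)
    (ε : ℝ) (hε : 0 < ε) : ∃ F : Finset G, F.Nonempty ∧
      ‖vectorCoeff (indicator 𝓡 F) a - (F.card : ℂ) • a‖ ≤ ε * F.card := by
  classical
  have key : ∀ a ∈ Submodule.span ℂ (Set.range fun l : List G =>
      ((l.map bracket).prod : PartialGroupAlgebra 𝓡)), ∃ (S : Finset G) (C : ℝ), 0 ≤ C ∧
      ∀ (F : Finset G) (ε : ℝ), 0 ≤ ε →
        (∀ g ∈ S, (1 - ε) * (F.card : ℝ) ≤ ((F.filter fun x => x * g ∈ F).card : ℝ)) →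
        ‖vectorCoeff (indicator 𝓡 F) a - (F.card : ℂ) • a‖ ≤ C * ε * F.card := by
    intro a ha
    induction ha using Submodule.span_induction with
    | mem a ha =>
      obtain ⟨l, rfl⟩ := ha
      refine ⟨{l.prod}, ‖((l.map bracket).prod : PartialGroupAlgebra 𝓡)‖, norm_nonneg _,
        fun F ε hε hF => ?_⟩
      have h1 := hF _ (Finset.mem_singleton_self _)
      have h2 : ((F.filter fun x => x * l.prod ∈ F).card : ℝ) ≤ F.card := by
        exact_mod_cast Finset.card_filter_le _ _
      dsimp only
      rw [vectorCoeff_indicator_word, ← sub_smul, norm_smul, mul_comm, mul_assoc]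
      refine mul_le_mul_of_nonneg_left ?_ (norm_nonneg _)
      rw [← Complex.ofReal_natCast, ← Complex.ofReal_natCast, ← Complex.ofReal_sub,
        Complex.norm_real, Real.norm_eq_abs, abs_le]
      constructor <;> nlinarith
    | zero => exact ⟨∅, 0, le_rfl, fun F ε hε hF => by simp⟩
    | add a b _ _ ha hb =>
      obtain ⟨S, C, hC, h⟩ := ha
      obtain ⟨T, D, hD, h'⟩ := hb
      refine ⟨S ∪ T, C + D, add_nonneg hC hD, fun F ε hε hF => ?_⟩
      have h1 := h F ε hε fun g hg => hF g (Finset.mem_union_left _ hg)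
      have h2 := h' F ε hε fun g hg => hF g (Finset.mem_union_right _ hg)
      rw [map_add, smul_add, add_sub_add_comm]
      refine (norm_add_le _ _).trans ?_
      linarith
    | smul c a _ ha =>
      obtain ⟨S, C, hC, h⟩ := ha
      refine ⟨S, ‖c‖ * C, by positivity, fun F ε hε hF => ?_⟩
      rw [map_smul, smul_comm, ← smul_sub, norm_smul, mul_assoc, mul_assoc, ← mul_assoc C]
      exact mul_le_mul_of_nonneg_left (h F ε hε hF) (norm_nonneg _)
  obtain ⟨b, hb, hab⟩ := Metric.dense_iff.1 (dense_span_words 𝓡) a (ε / 3) (by positivity)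
  obtain ⟨S, C, hC, h⟩ := key b hab
  obtain ⟨F, hF, hFS⟩ := hG S (ε / (3 * (C + 1))) (by positivity)
  refine ⟨F, hF, ?_⟩
  have h1 := h F _ (by positivity) hFS
  have h2 : ‖a - b‖ ≤ ε / 3 := by
    rw [← dist_eq_norm, dist_comm]
    exact (Metric.mem_ball.1 hb).le
  have h3 : ‖vectorCoeff (indicator 𝓡 F) (a - b)‖ ≤ F.card * (ε / 3) :=
    (norm_vectorCoeff_le _ _).trans
      (mul_le_mul (norm_indicator_sq_le F) h2 (norm_nonneg _) (by positivity))
  have h4 : ‖(F.card : ℂ) • (b - a)‖ ≤ F.card * (ε / 3) := by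
    rw [norm_smul, norm_sub_rev]
    simpa using mul_le_mul_of_nonneg_left h2 (Nat.cast_nonneg (α := ℝ) F.card)
  have h5 : C * (ε / (3 * (C + 1))) * F.card ≤ F.card * (ε / 3) := by
    rw [mul_comm]
    refine mul_le_mul_of_nonneg_left ?_ (by positivity)
    rw [← mul_div_assoc, div_le_div_iff₀ (by positivity) (by positivity)]
    nlinarith
  have h6 : vectorCoeff (indicator 𝓡 F) a - (F.card : ℂ) • a =
      vectorCoeff (indicator 𝓡 F) (a - b) +
      (vectorCoeff (indicator 𝓡 F) b - (F.card : ℂ) • b) + (F.card : ℂ) • (b - a) := by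
    rw [map_sub, smul_sub]
    abel
  rw [h6]
  refine (norm_add₃_le).trans ?_
  linarith

theorem expectation_faithful (hG : FolnerCondition G) (a : PartialGroupAlgebra 𝓡)
    (ha : expectation 𝓡 (star a * a) = 0) : a = 0 := by
  rw [← star_eq_zero, ← norm_le_zero_iff]
  refine le_of_forall_pos_le_add fun ε hε => ?_
  obtain ⟨F, hF, h⟩ := exists_norm_vectorCoeff_sub_le hG (star a) ε hε
  have h1 := norm_vectorCoeff_indicator_sq_le F (star a)
  rw [star_star, ha, norm_zero, mul_zero] at h1
  have h2 : vectorCoeff (indicator 𝓡 F) (star a) = 0 :=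
    norm_eq_zero.1 (pow_eq_zero_iff two_ne_zero |>.1 (le_antisymm h1 (sq_nonneg _)))
  rw [h2, zero_sub, norm_neg, norm_smul, Complex.norm_natCast, mul_comm ε] at h
  have h3 : (0 : ℝ) < F.card := by exact_mod_cast hF.card_pos
  rw [zero_add]
  exact le_of_mul_le_mul_left h h3

/-- For amenable `G`, `expectation 𝓡` is a faithful conditional expectation onto the C*-subalgebra
generated by the projections `e_g`. -/
theorem isFaithfulConditionalExpectation (hG : FolnerCondition G) :
    IsFaithfulConditionalExpectation
      (cstarSubalgebra (Set.range (e : G → PartialGroupAlgebra 𝓡)))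
      (expectation 𝓡).toLinearMap where
  mem := expectation_mem
  apply_of_mem b hb := by
    have h := (expectation_bimodule b hb).1 1
    have h1 : expectation 𝓡 1 = 1 := by
      simpa using expectation_word (𝓡 := 𝓡) []
    rwa [h1, mul_one] at h
  map_mul_left b a hb := (expectation_bimodule b hb).1 a
  map_mul_right a b hb := (expectation_bimodule b hb).2 a
  positive a := StarSubalgebra.exists_star_mul_self_eq _ (isClosed_cstarSubalgebra _)
    (expectation_mem _) (expectation_star_mul_self_nonneg a)
  norm_le := norm_expectation_le
  faithful := expectation_faithful hG

end PartialGroupAlgebra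

/-! ### Projections in a C*-algebra that sum to one -/

/-- Projections with sum `1` are pairwise orthogonal: `p j * (∑ i, p i) * p j = p j` is a sum of
positive elements one of which is `p j`. -/
theorem mul_eq_zero_of_sum_projections_eq_one {A ι : Type*} [CStarAlgebra A] [Fintype ι]
    (p : ι → A) (hp : ∀ i, IsStarProjection (p i)) (h : ∑ i, p i = 1) {i j : ι} (hij : i ≠ j) :
    p i * p j = 0 := by
  classical
  let _ := CStarAlgebra.spectralOrder A
  let _ := CStarAlgebra.spectralOrderedRing A
  have hsa : ∀ i, star (p i) = p i := fun i => (hp i).isSelfAdjoint.star_eq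
  have hid : ∀ i, p i * p i = p i := fun i => (hp i).isIdempotentElem
  have h1 : ∑ k ∈ Finset.univ.erase j, star (p k * p j) * (p k * p j) = 0 := by
    have h2 : ∑ k, star (p k * p j) * (p k * p j) = p j := by
      calc ∑ k, star (p k * p j) * (p k * p j) = ∑ k, p j * p k * p j :=
            Finset.sum_congr rfl fun k _ => by
              rw [star_mul, hsa, hsa, mul_assoc, ← mul_assoc (p k), hid, mul_assoc]
        _ = p j := by rw [← Finset.sum_mul, ← Finset.mul_sum, h, mul_one, hid]
    have h3 := Finset.add_sum_erase Finset.univ (fun k => star (p k * p j) * (p k * p j))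
      (Finset.mem_univ j)
    rw [h2, hid, hsa, hid] at h3
    exact add_eq_left.1 h3
  rw [Finset.sum_eq_zero_iff_of_nonneg fun k _ => star_mul_self_nonneg _] at h1
  exact (CStarRing.star_mul_self_eq_zero_iff _).1
    (h1 i (Finset.mem_erase.2 ⟨hij, Finset.mem_univ i⟩))

/-! ### Homomorphisms from a universal C*-algebra -/

/-- Homomorphisms from a universal C*-algebra that agree on the generators are equal. -/
theorem UniversalCStarAlgebra.hom_ext {X B : Type*} {rel : Set (FreeStarAlgebra X)}
    [BoundedRelations rel] [CStarAlgebra B] {f g : UniversalCStarAlgebra rel →⋆ₐ[ℂ] B}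
    (h : ∀ x, f (gen x) = g (gen x)) : f = g := by
  have hc : ∀ f : UniversalCStarAlgebra rel →⋆ₐ[ℂ] B, Continuous f := fun f =>
    AddMonoidHomClass.continuous_of_bound f 1 fun a => by
      simpa using NonUnitalStarAlgHom.norm_apply_le f a
  refine DFunLike.coe_injective (denseRange_mkHom.equalizer (hc f) (hc g) (funext fun a => ?_))
  simp only [Function.comp_apply]
  induction a using FreeStarAlgebra.induct with
  | scalar c => rw [AlgHomClass.commutes, AlgHomClass.commutes, AlgHomClass.commutes]
  | of x => exact h x
  | ofStar x =>
    rw [← FreeStarAlgebra.star_of, map_star, map_star, map_star, mkHom_of, h x]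
  | mul a b ha hb => rw [map_mul, map_mul, map_mul, ha, hb]
  | add a b ha hb => rw [map_add, map_add, map_add, ha, hb]

/-! ### Fractions in `K ⋊ Kˣ` -/

namespace RegularCStarAlgebra

section Fractions

open AffineGroup

variable (R : Type*) [CommRing R] [IsDomain R] {K : Type*} [Field K] [Algebra R K]
  [IsFractionRing R K]

/-- `g = (n / d, m / d)`, written without denominators. -/
def IsFraction (g : AffineGroup K) (d : R⁰) (n : R) (m : R⁰) : Prop :=
  pair 0 (toUnits R K d) * g = pair (algebraMap R K n) (toUnits R K m)

variable {R}

theorem toUnits_mul (m m' : R⁰) : toUnits R K (m * m') = toUnits R K m * toUnits R K m' := by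
  ext
  simp [toUnits]

theorem toUnits_one : toUnits R K 1 = 1 := by
  ext
  simp [toUnits]

theorem coe_toUnits (m : R⁰) : (toUnits R K m : K) = algebraMap R K m := rfl

theorem toUnits_injective : Function.Injective (toUnits R K) := fun _ _ h =>
  Subtype.ext (IsFractionRing.injective R K (congrArg Units.val h))

theorem pair_injective {x x' : K} {w w' : Kˣ} : pair x w = pair x' w' ↔ x = x' ∧ w = w' :=
  ⟨fun h => ⟨congrArg (fun g => g.left.toAdd) h, congrArg (fun g => g.right) h⟩,
    fun h => by rw [h.1, h.2]⟩

theorem exists_pair (g : AffineGroup K) : ∃ x w, g = pair x w := ⟨g.left.toAdd, g.right, rfl⟩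

variable (R) in
theorem exists_isFraction (g : AffineGroup K) : ∃ d n m, IsFraction R g d n m := by
  obtain ⟨x, w, rfl⟩ := exists_pair g
  obtain ⟨a, b, rfl⟩ := IsLocalization.exists_mk'_eq R⁰ x
  obtain ⟨p, q, h⟩ := IsLocalization.exists_mk'_eq R⁰ (w : K)
  have hp : p ∈ R⁰ := by
    rw [mem_nonZeroDivisors_iff_ne_zero]
    rintro rfl
    rw [IsLocalization.mk'_zero] at h
    exact w.ne_zero h.symm
  refine ⟨b * q, a * q, ⟨p, hp⟩ * b, ?_⟩
  rw [IsFraction, pair_mul, zero_add, pair_injective]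
  have h1 := IsLocalization.mk'_spec K a b
  have h2 := IsLocalization.mk'_spec K p q
  constructor
  · rw [coe_toUnits, Submonoid.coe_mul, map_mul, map_mul, ← mul_assoc, h1]
  · ext
    rw [Units.val_mul, coe_toUnits, coe_toUnits, ← h, Submonoid.coe_mul, Submonoid.coe_mul, map_mul,
      map_mul]
    rw [← h2]
    ring

theorem IsFraction.inv {g : AffineGroup K} {d m : R⁰} {n : R} (h : IsFraction R g d n m) :
    IsFraction R g⁻¹ m (-n) d := by
  rw [IsFraction] at h ⊢
  have h1 : pair (algebraMap R K n) (toUnits R K m) =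
      pair (algebraMap R K n) 1 * pair 0 (toUnits R K m) := by simp [pair_mul]
  have h2 : pair (algebraMap R K (-n)) (toUnits R K d) =
      (pair (algebraMap R K n) 1)⁻¹ * pair 0 (toUnits R K d) := by simp [pair_inv, pair_mul]
  rw [h2, eq_inv_mul_iff_mul_eq, ← mul_assoc, ← h1, ← h, mul_inv_cancel_right]

theorem IsFraction.mul {g h : AffineGroup K} {d m k m' : R⁰} {n n' : R}
    (hg : IsFraction R g d n m) (hh : IsFraction R h k n' m') :
    IsFraction R (g * h) (k * d) (k * n + m * n') (m * m') := by
  rw [IsFraction] at hg hh ⊢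
  have h1 : (pair 0 (toUnits R K (k * d)) : AffineGroup K) =
      pair 0 (toUnits R K k) * pair 0 (toUnits R K d) := by simp [pair_mul, toUnits_mul]
  have h2 : (pair 0 (toUnits R K k) : AffineGroup K) * pair (algebraMap R K n) (toUnits R K m) =
      pair (algebraMap R K (k * n)) (toUnits R K m) * pair 0 (toUnits R K k) := by
    simp [pair_mul, coe_toUnits, mul_comm]
  rw [h1, mul_assoc, ← mul_assoc _ g h, hg, ← mul_assoc, h2, mul_assoc, hh, pair_mul,
    toUnits_mul, coe_toUnits]
  congr 1
  simp [mul_comm]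

theorem isFraction_pair (n : R) (m : R⁰) :
    IsFraction R (pair (algebraMap R K n) (toUnits R K m)) 1 n m := by
  simp [IsFraction, toUnits_one, pair_zero_one]

/-- The degree of the word that corresponds to `s_{m''}^* u^n s_m s_m^* u^{-n'} s_{m'}`. -/
theorem prod_monomial_eq_one_iff (m m' m'' : R⁰) (n n' : R) :
    [(pair 0 (toUnits R K m''))⁻¹, pair (algebraMap R K n) 1, pair 0 (toUnits R K m),
      (pair 0 (toUnits R K m))⁻¹, pair (algebraMap R K (-n')) 1,
      pair 0 (toUnits R K m')].prod = 1 ↔ m' = m'' ∧ n = n' := by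
  simp only [List.prod_cons, List.prod_nil, mul_one, mul_inv_cancel_left]
  rw [inv_mul_eq_one, pair_mul, pair_mul, pair_injective, eq_comm (a := (0 : K)), one_mul, one_mul,
    (toUnits_injective (R := R) (K := K)).eq_iff, and_comm, eq_comm (a := m'')]
  simp [← sub_eq_add_neg, sub_eq_zero]

end Fractions

section Residues

variable {R : Type*} [CommRing R]

/-- A system of representatives of the residue classes modulo `m`. -/
def residue (m : R⁰) (q : R ⧸ Ideal.span {(m : R)}) : R :=
  Function.surjInv Ideal.Quotient.mk_surjective q

theorem mk_residue (m : R⁰) (q : R ⧸ Ideal.span {(m : R)}) :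
    Ideal.Quotient.mk _ (residue m q) = q :=
  Function.surjInv_eq _ q

end Residues

open UniversalCStarAlgebra

variable {R : Type*} [CommRing R] [IsDomain R] [FinitePrincipalQuotients R]

/-! ### Calculation rules in the regular C*-algebra -/

theorem star_s_mul_s (m : R⁰) : star (s m) * s m = 1 := by
  have := mkHom_rel (rel := relations R) (Rel.isometry m)
  rwa [map_sub, map_mul, map_star, map_one, sub_eq_zero] at this

theorem star_u_mul_u (n : R) : star (u n) * u n = 1 := by
  have := mkHom_rel (rel := relations R) (Rel.unitary_left n)
  rwa [map_sub, map_mul, map_star, map_one, sub_eq_zero] at this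

theorem s_mul_s (m m' : R⁰) : s m * s m' = s (m * m') := by
  have := mkHom_rel (rel := relations R) (Rel.cl1 m m')
  rwa [map_sub, map_mul, sub_eq_zero] at this

theorem u_mul_u (n n' : R) : u n * u n' = u (n + n') := by
  have := mkHom_rel (rel := relations R) (Rel.cl2 n n')
  rwa [map_sub, map_mul, sub_eq_zero] at this

theorem s_mul_u (m : R⁰) (n : R) : s m * u n = u (m * n) * s m := by
  have := mkHom_rel (rel := relations R) (Rel.cl3 m n)
  rwa [map_sub, map_mul, map_mul, sub_eq_zero] at this

theorem u_zero : u (0 : R) = 1 := by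
  have h := congrArg (star (u (0 : R)) * ·) (u_mul_u (0 : R) 0)
  simpa [← mul_assoc, star_u_mul_u] using h

theorem s_one : s (1 : R⁰) = 1 := by
  have h := congrArg (star (s (1 : R⁰)) * ·) (s_mul_s (1 : R⁰) 1)
  simpa [← mul_assoc, star_s_mul_s] using h

theorem star_u (n : R) : star (u n) = u (-n) := by
  have h : u n * u (-n) = 1 := by rw [u_mul_u, add_neg_cancel, u_zero]
  rw [← mul_one (star (u n)), ← h, ← mul_assoc, star_u_mul_u, one_mul]

theorem star_s_mul_star_s (m m' : R⁰) : star (s m) * star (s m') = star (s (m * m')) := by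
  rw [← star_mul, s_mul_s, mul_comm]

theorem u_mul_star_s (n : R) (m : R⁰) : u n * star (s m) = star (s m) * u (m * n) := by
  have h := congrArg star (s_mul_u m (-n))
  rw [star_mul, star_mul, star_u, star_u] at h
  simpa using h

/-- The projection `u^n s_m s_m^* u^{-n}`. -/
def proj (n : R) (m : R⁰) : RegularCStarAlgebra R := u n * s m * star (s m) * u (-n)

theorem proj_eq (n : R) (m : R⁰) : proj n m = (u n * s m) * star (u n * s m) := by
  rw [proj, star_mul, star_u]
  noncomm_ring

theorem star_mul_self_u_mul_s (n : R) (m : R⁰) : star (u n * s m) * (u n * s m) = 1 := by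
  rw [star_mul, mul_assoc, ← mul_assoc (star (u n)), star_u_mul_u, one_mul, star_s_mul_s]

theorem isStarProjection_proj (n : R) (m : R⁰) : IsStarProjection (proj n m) where
  isIdempotentElem := by
    rw [IsIdempotentElem, proj_eq, mul_assoc, ← mul_assoc (star _), star_mul_self_u_mul_s, one_mul]
  isSelfAdjoint := by
    rw [IsSelfAdjoint, proj_eq, star_mul, star_star]

/-- `u^n s_m s_m^* u^{-n}` depends only on the class of `n` modulo `m`. -/
theorem proj_add_mul (n k : R) (m : R⁰) : proj (n + m * k) m = proj n m := by
  have h : u (n + m * k) * s m = u n * s m * u k := by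
    rw [← u_mul_u, mul_assoc, ← s_mul_u, mul_assoc]
  rw [proj_eq, proj_eq, h, star_mul, star_u, ← mul_assoc, mul_assoc (u n * s m), u_mul_u,
    add_neg_cancel, u_zero, mul_one]

theorem sum_proj (m : R⁰) (c : R ⧸ Ideal.span {(m : R)} → R)
    (hc : ∀ q, Ideal.Quotient.mk _ (c q) = q) : ∑ q, proj (c q) m = 1 := by
  have := mkHom_rel (rel := relations R) (Rel.cl4 m c hc)
  rw [map_sub, map_sum, map_one, sub_eq_zero] at this
  rw [← this]
  refine Finset.sum_congr rfl fun q _ => ?_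
  rw [map_mul, map_mul, map_mul, map_star]
  rfl

theorem proj_residue (n : R) (m : R⁰) :
    proj (residue m (Ideal.Quotient.mk _ n)) m = proj n m := by
  obtain ⟨k, hk⟩ := Ideal.mem_span_singleton.1 (Ideal.Quotient.eq.1 (mk_residue m
    (Ideal.Quotient.mk _ n)))
  rw [← proj_add_mul n k m, ← hk, add_sub_cancel]

open Classical in
theorem proj_mul_proj (n n' : R) (m : R⁰) : proj n m * proj n' m =
    if Ideal.Quotient.mk (Ideal.span {(m : R)}) n = Ideal.Quotient.mk _ n'
      then proj n m else 0 := by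
  split_ifs with h
  · rw [← proj_residue n', ← h, proj_residue, (isStarProjection_proj n m).isIdempotentElem]
  · rw [← proj_residue n, ← proj_residue n']
    exact mul_eq_zero_of_sum_projections_eq_one (fun q => proj (residue m q) m)
      (fun q => isStarProjection_proj _ _) (sum_proj m _ (mk_residue m)) h

/-- A residue class modulo `m` is the disjoint union of residue classes modulo `m m'`. -/
theorem proj_eq_sum (n : R) (m m' : R⁰) :
    proj n m = ∑ q, proj (n + m * residue m' q) (m * m') := by
  have h : ∀ q, proj (n + m * residue m' q) (m * m') =
      u n * s m * proj (residue m' q) m' * star (u n * s m) := by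
    intro q
    have h1 : u (n + m * residue m' q) * s (m * m') = u n * s m * (u (residue m' q) * s m') := by
      rw [← u_mul_u, ← s_mul_s, mul_assoc, ← mul_assoc (u ((m : R) * _)), ← s_mul_u]
      noncomm_ring
    rw [proj_eq, proj_eq, h1, star_mul (u n * s m)]
    noncomm_ring
  simp only [h]
  rw [← Finset.sum_mul, ← Finset.mul_sum, sum_proj m' _ (mk_residue m'), mul_one, proj_eq]

theorem commute_proj (n n' : R) (m m' : R⁰) : Commute (proj n m) (proj n' m') := by
  classical
  rw [proj_eq_sum n m m', proj_eq_sum n' m' m, mul_comm m' m]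
  refine Commute.sum_left _ _ _ fun q _ => Commute.sum_right _ _ _ fun q' _ => ?_
  rw [Commute, SemiconjBy, proj_mul_proj, proj_mul_proj]
  by_cases h : Ideal.Quotient.mk (Ideal.span {((m * m' : R⁰) : R)}) (n + m * residue m' q) =
    Ideal.Quotient.mk _ (n' + m' * residue m q')
  · rw [if_pos h, if_pos h.symm, ← proj_residue (n + m * residue m' q), h, proj_residue]
  · rw [if_neg h, if_neg (Ne.symm h)]

/-- An intersection of residue classes modulo `m` and `m'` is a union of classes modulo `m m'`. -/
theorem proj_mul_proj_mem_span (n n' : R) (m m' : R⁰) :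
    proj n m * proj n' m' ∈ Submodule.span ℂ (Set.range fun k => proj k (m * m')) := by
  classical
  rw [proj_eq_sum n m m', proj_eq_sum n' m' m, mul_comm m' m, Finset.sum_mul_sum]
  refine Submodule.sum_mem _ fun q _ => Submodule.sum_mem _ fun q' _ => ?_
  rw [proj_mul_proj]
  split_ifs
  · exact Submodule.subset_span ⟨_, rfl⟩
  · exact Submodule.zero_mem _

/-- Since `s_k s_k^*` commutes with `u^n s_m s_m^* u^{-n}`, moving `s_m'` past `s_k^*` makes no
difference next to the latter projection and `s_k`. -/
theorem s_mul_star_s_mul_proj_mul_s (m' k m : R⁰) (n : R) :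
    s m' * star (s k) * proj n m * s k = star (s k) * s m' * proj n m * s k := by
  have h : s k * star (s k) * proj n m = proj n m * (s k * star (s k)) := by
    have := commute_proj 0 n k m
    rwa [proj, neg_zero, u_zero, one_mul, mul_one] at this
  have h1 : s m' = star (s k) * (s m' * s k) := by
    rw [s_mul_s, mul_comm m' k, ← s_mul_s, ← mul_assoc, star_s_mul_s, one_mul]
  calc s m' * star (s k) * proj n m * s k
      = star (s k) * s m' * (s k * star (s k) * proj n m) * s k := by
        conv_lhs => rw [h1]
        noncomm_ring
    _ = star (s k) * s m' * proj n m * s k * (star (s k) * s k) := by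
        rw [h]
        noncomm_ring
    _ = _ := by rw [star_s_mul_s, mul_one]

/-! ### The inverse of `Ψ` -/

section Inverse

open AffineGroup PartialGroupAlgebra

variable {K : Type*} [Field K] [Algebra R K] [IsFractionRing R K]

/-- The element `s_d^* u^n s_m` only depends on `(n / d, m / d)`. -/
theorem IsFraction.unique {g : AffineGroup K} {d m d' m' : R⁰} {n n' : R}
    (h : IsFraction R g d n m) (h' : IsFraction R g d' n' m') :
    star (s d) * u n * s m = star (s d') * u n' * s m' := by
  have expand : ∀ (c d m : R⁰) (n : R),
      star (s d) * u n * s m = star (s (d * c)) * u (c * n) * s (c * m) := by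
    intro c d m n
    rw [← star_s_mul_star_s, ← s_mul_s, mul_assoc (star (s d)) (star (s c)), ← u_mul_star_s]
    calc star (s d) * u n * s m = star (s d) * u n * (star (s c) * s c) * s m := by
          rw [star_s_mul_s, mul_one]
      _ = _ := by noncomm_ring
  obtain ⟨x, w, rfl⟩ := exists_pair g
  rw [IsFraction, pair_mul, zero_add, pair_injective, coe_toUnits] at h h'
  have hn : (d' : R) * n = d * n' := by
    apply IsFractionRing.injective R K
    rw [map_mul, map_mul, ← h.1, ← h'.1]
    ring
  have hm : d' * m = d * m' := by
    apply toUnits_injective (K := K)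
    rw [toUnits_mul, toUnits_mul, ← h.2, ← h'.2, mul_left_comm]
  rw [expand d' d m n, expand d d' m' n', hn, hm, mul_comm d d']

variable (R) in
/-- The images of the generators under the inverse of `Ψ`: `[n / d, m / d] ↦ s_d^* u^n s_m`. -/
def phiGen (g : AffineGroup K) : RegularCStarAlgebra R :=
  star (s (exists_isFraction R g).choose) * u (exists_isFraction R g).choose_spec.choose *
    s (exists_isFraction R g).choose_spec.choose_spec.choose

theorem IsFraction.phiGen_eq {g : AffineGroup K} {d m : R⁰} {n : R} (h : IsFraction R g d n m) :
    phiGen R g = star (s d) * u n * s m :=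
  IsFraction.unique (exists_isFraction R g).choose_spec.choose_spec.choose_spec h

theorem phiGen_pair (n : R) (m : R⁰) :
    phiGen R (pair (algebraMap R K n) (toUnits R K m)) = u n * s m := by
  rw [(isFraction_pair n m).phiGen_eq, s_one, star_one, one_mul]

theorem phiGen_pair_one (n : R) : phiGen R (pair (algebraMap R K n) 1) = u n := by
  rw [← toUnits_one (R := R), phiGen_pair, s_one, mul_one]

theorem phiGen_pair_zero (m : R⁰) : phiGen R (pair 0 (toUnits R K m)) = s m := by
  rw [← map_zero (algebraMap R K), phiGen_pair, u_zero, one_mul]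

theorem phiGen_inv (g : AffineGroup K) : phiGen R g⁻¹ = star (phiGen R g) := by
  obtain ⟨d, n, m, h⟩ := exists_isFraction R g
  rw [h.inv.phiGen_eq, h.phiGen_eq, star_mul, star_mul, star_star, star_u, mul_assoc]

theorem phiGen_mul (g h : AffineGroup K) :
    phiGen R g * phiGen R h * phiGen R h⁻¹ = phiGen R (g * h) * phiGen R h⁻¹ := by
  obtain ⟨d, n, m, hg⟩ := exists_isFraction R g
  obtain ⟨k, n', m', hh⟩ := exists_isFraction R h
  rw [(hg.mul hh).phiGen_eq, hg.phiGen_eq, hh.phiGen_eq, hh.inv.phiGen_eq, mul_comm k d,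
    ← star_s_mul_star_s, ← s_mul_s, ← u_mul_u]
  calc star (s d) * u n * s m * (star (s k) * u n' * s m') * (star (s m') * u (-n') * s k)
      = star (s d) * u n * (s m * star (s k) * proj n' m' * s k) := by rw [proj]; noncomm_ring
    _ = star (s d) * (u n * star (s k)) * s m * proj n' m' * s k := by
        rw [s_mul_star_s_mul_proj_mul_s]
        noncomm_ring
    _ = star (s d) * star (s k) * u (k * n) * (s m * u n') * s m' * star (s m') * u (-n') *
          s k := by
        rw [u_mul_star_s, proj]
        noncomm_ring
    _ = _ := by
        rw [s_mul_u]
        noncomm_ring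

variable (R K) in
theorem phiGen_relations : ∀ r ∈ PartialGroupAlgebra.relations (partialRelations R K),
    FreeStarAlgebra.eval (phiGen R) r = 0 := by
  have hsubst : ∀ f : FreeAlgebra ℂ (AffineGroup K),
      FreeStarAlgebra.eval (phiGen R) (substE _ f) =
        FreeAlgebra.lift ℂ (fun g => phiGen R g * phiGen R g⁻¹) f := by
    intro f
    have : (FreeStarAlgebra.eval (phiGen R)).toAlgHom.comp (substE (AffineGroup K)) =
        FreeAlgebra.lift ℂ (fun g => phiGen R g * phiGen R g⁻¹) := by
      refine FreeAlgebra.hom_ext (funext fun g => ?_)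
      simp only [Function.comp_apply, AlgHom.comp_apply, substE, FreeAlgebra.lift_ι_apply]
      refine (map_mul (FreeStarAlgebra.eval (phiGen R)) _ _).trans ?_
      rw [FreeStarAlgebra.eval_of, FreeStarAlgebra.eval_of]
    exact DFunLike.congr_fun this f
  rintro r (hr | ⟨f, hf, rfl⟩)
  · cases hr with
    | one =>
      rw [map_sub, map_one, FreeStarAlgebra.eval_of, ← pair_zero_one, ← map_zero (algebraMap R K),
        phiGen_pair_one, u_zero, sub_self]
    | inv g =>
      rw [map_sub, map_star, FreeStarAlgebra.eval_of, FreeStarAlgebra.eval_of, phiGen_inv, sub_self]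
    | mul g h =>
      simp only [map_sub, map_mul, FreeStarAlgebra.eval_of]
      rw [phiGen_mul, sub_self]
  · rw [hsubst]
    cases hf with
    | r1 n =>
      rw [map_sub, map_one, FreeAlgebra.lift_ι_apply, phiGen_inv, phiGen_pair_one, star_u, u_mul_u,
        add_neg_cancel, u_zero, sub_self]
    | r2 m =>
      have h : (pair 0 (toUnits R K m)⁻¹ : AffineGroup K) = (pair 0 (toUnits R K m))⁻¹ := by
        simp [pair_inv]
      rw [map_sub, map_one, FreeAlgebra.lift_ι_apply, h, inv_inv, phiGen_inv, phiGen_pair_zero,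
        star_s_mul_s, sub_self]
    | r3 m c hc =>
      rw [map_sub, map_one, map_sum, sub_eq_zero, ← sum_proj m c hc]
      refine Finset.sum_congr rfl fun q _ => ?_
      rw [FreeAlgebra.lift_ι_apply, phiGen_inv, phiGen_pair, proj_eq]

variable (R K) in
/-- The inverse of `Ψ`. -/
def phi : AffinePartialGroupAlgebra R K →⋆ₐ[ℂ] RegularCStarAlgebra R :=
  UniversalCStarAlgebra.lift (phiGen R) (phiGen_relations R K)

theorem phi_bracket (g : AffineGroup K) : phi R K (bracket g) = phiGen R g :=
  UniversalCStarAlgebra.lift_gen _ _ _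

/-- `Ψ(s_d^* u^n s_m) = [n / d, m / d]`. -/
theorem IsFraction.psi_eq {g : AffineGroup K} {d m : R⁰} {n : R} (h : IsFraction R g d n m) :
    psi R K (star (s d) * u n * s m) = bracket g := by
  rw [map_mul, map_mul, map_star, psi_s, psi_s, psi_u, mul_assoc, br_one_mul_br, add_zero, br, br,
    ← h, star_bracket, bracket_mul_of_coisometry, inv_mul_cancel_left]
  rw [pair_inv, neg_zero, zero_div]
  exact e_r2 d

variable (R K)

theorem psi_comp_phi : (psi R K).comp (phi R K) = StarAlgHom.id ℂ _ := by
  refine UniversalCStarAlgebra.hom_ext fun g => ?_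
  obtain ⟨d, n, m, h⟩ := exists_isFraction R g
  change psi R K (phi R K (bracket g)) = bracket g
  rw [phi_bracket, h.phiGen_eq, h.psi_eq]

theorem phi_comp_psi : (phi R K).comp (psi R K) = StarAlgHom.id ℂ _ := by
  refine UniversalCStarAlgebra.hom_ext fun x => ?_
  cases x with
  | s m =>
    change phi R K (psi R K (s m)) = s m
    rw [psi_s, br, phi_bracket, phiGen_pair_zero]
  | u n =>
    change phi R K (psi R K (u n)) = u n
    rw [psi_u, br, phi_bracket, phiGen_pair_one]

theorem psi_bijective : Function.Bijective (psi R K) :=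
  Function.bijective_iff_has_inverse.2 ⟨phi R K, DFunLike.congr_fun (phi_comp_psi R K),
    DFunLike.congr_fun (psi_comp_phi R K)⟩

end Inverse

end RegularCStarAlgebra

/-! ### Transport of conditional expectations -/

theorem map_mem_cstarSubalgebra {A B : Type*} [CStarAlgebra A] [CStarAlgebra B]
    (f : A →⋆ₐ[ℂ] B) {S : Set A} {T : Set B} (h : ∀ a ∈ S, f a ∈ T) {a : A}
    (ha : a ∈ cstarSubalgebra S) : f a ∈ cstarSubalgebra T := by
  have hc : Continuous f := AddMonoidHomClass.continuous_of_bound f 1 fun a => by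
    simpa using NonUnitalStarAlgHom.norm_apply_le f a
  refine map_mem_closure hc ha fun b hb => ?_
  have h1 : StarAlgebra.adjoin ℂ S ≤ (StarAlgebra.adjoin ℂ T).comap f :=
    StarAlgebra.adjoin_le fun a ha => StarAlgebra.subset_adjoin ℂ T (h a ha)
  exact h1 hb

/-- Transport of a conditional expectation along mutually inverse `*`-homomorphisms that match the
generators of the two subalgebras. -/
theorem IsFaithfulConditionalExpectation.conj {A B : Type*} [CStarAlgebra A] [CStarAlgebra B]
    (f : A →⋆ₐ[ℂ] B) (f' : B →⋆ₐ[ℂ] A) (hf : ∀ a, f' (f a) = a) (hf' : ∀ b, f (f' b) = b)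
    {S : Set A} {T : Set B} (h : ∀ a ∈ S, f a ∈ T) (h' : ∀ b ∈ T, f' b ∈ S) {E : B →ₗ[ℂ] B}
    (hE : IsFaithfulConditionalExpectation (cstarSubalgebra T) E) :
    IsFaithfulConditionalExpectation (cstarSubalgebra S)
      (f'.toAlgHom.toLinearMap ∘ₗ E ∘ₗ f.toAlgHom.toLinearMap) := by
  have hS : ∀ a ∈ cstarSubalgebra S, f a ∈ cstarSubalgebra T :=
    fun a => map_mem_cstarSubalgebra f h
  have hT : ∀ b ∈ cstarSubalgebra T, f' b ∈ cstarSubalgebra S :=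
    fun b => map_mem_cstarSubalgebra f' h'
  have happ : ∀ a, (f'.toAlgHom.toLinearMap ∘ₗ E ∘ₗ f.toAlgHom.toLinearMap) a = f' (E (f a)) :=
    fun _ => rfl
  refine ⟨fun a => ?_, fun b hb => ?_, fun b a hb => ?_, fun a b hb => ?_, fun a => ?_,
    fun a => ?_, fun a ha => ?_⟩
  · exact hT _ (hE.mem _)
  · rw [happ, hE.apply_of_mem _ (hS b hb), hf]
  · rw [happ, happ, map_mul, hE.map_mul_left _ _ (hS b hb), map_mul, hf]
  · rw [happ, happ, map_mul, hE.map_mul_right _ _ (hS b hb), map_mul, hf]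
  · obtain ⟨c, hc, h⟩ := hE.positive (f a)
    refine ⟨f' c, hT c hc, ?_⟩
    rw [happ, map_mul, map_star, h, map_mul, map_star]
  · exact (NonUnitalStarAlgHom.norm_apply_le f' _).trans
      ((hE.norm_le _).trans (NonUnitalStarAlgHom.norm_apply_le f a))
  · rw [happ, map_mul, map_star] at ha
    have h1 := congrArg f ha
    rw [hf', map_zero] at h1
    rw [← hf a, hE.faithful _ h1, map_zero]

namespace RegularCStarAlgebra

open PartialGroupAlgebra AffineGroup UniversalCStarAlgebra

section Monomials

variable (R : Type*) [CommRing R] [IsDomain R] [FinitePrincipalQuotients R]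

/-! ### The monomials span a dense subspace -/

/-- The monomials `s_{m''}^* u^n s_m s_m^* u^{-n'} s_{m'}`. -/
def monomials : Set (RegularCStarAlgebra R) :=
  {a | ∃ (m m' m'' : R⁰) (n n' : R), a = star (s m'') * u n * s m * star (s m) * u (-n') * s m'}

variable {R}

theorem star_s_mul_mem_monomials (c : R⁰) {a : RegularCStarAlgebra R} (ha : a ∈ monomials R) :
    star (s c) * a ∈ monomials R := by
  obtain ⟨m, m', m'', n, n', rfl⟩ := ha
  refine ⟨m, m', c * m'', n, n', ?_⟩
  rw [← star_s_mul_star_s]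
  noncomm_ring

theorem u_mul_mem_monomials (k : R) {a : RegularCStarAlgebra R} (ha : a ∈ monomials R) :
    u k * a ∈ monomials R := by
  obtain ⟨m, m', m'', n, n', rfl⟩ := ha
  refine ⟨m, m', m'', m'' * k + n, n', ?_⟩
  rw [← u_mul_u, ← mul_assoc (star (s m'')), ← u_mul_star_s]
  noncomm_ring

theorem star_s_mul_s_mul_proj_mul_mem_monomials (a b c l : R⁰) (j k : R) :
    star (s a) * s c * proj k l * u j * s b ∈ monomials R := by
  refine ⟨c * l, c * b, a, c * k, -(c * (-k + j)), ?_⟩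
  rw [neg_neg, ← s_mul_s c l, ← s_mul_s c b, star_mul]
  have h1 : star (s c) * u (c * (-k + j)) * s c = u (-k) * u j := by
    rw [← u_mul_star_s, mul_assoc, star_s_mul_s, mul_one, u_mul_u]
  calc star (s a) * s c * proj k l * u j * s b
      = star (s a) * (s c * u k) * s l * star (s l) * (u (-k) * u j) * s b := by
        rw [proj]
        noncomm_ring
    _ = _ := by
        rw [s_mul_u, ← h1]
        noncomm_ring

/-- Left multiplication by `s_c` maps monomials into their span: `s_c` is moved past
`s_{m''}^*` at the expense of the projection `s_{m''} s_{m''}^*`, whose product with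
`u^n s_m s_m^* u^{-n}` is a sum of projections of this form. -/
theorem s_mul_mem_span_monomials (c : R⁰) {a : RegularCStarAlgebra R} (ha : a ∈ monomials R) :
    s c * a ∈ Submodule.span ℂ (monomials R) := by
  obtain ⟨m, b, a, n, n', rfl⟩ := ha
  have h : s c * (star (s a) * u n * s m * star (s m) * u (-n') * s b) =
      star (s a) * s c * (proj 0 a * proj n m) * u (n - n') * s b := by
    have h1 : s c * star (s a) = star (s a) * s c * proj 0 a := by
      calc s c * star (s a) = star (s a) * s a * s c * star (s a) := by
            rw [star_s_mul_s, one_mul]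
        _ = star (s a) * (s a * s c) * star (s a) := by noncomm_ring
        _ = star (s a) * (s c * s a) * star (s a) := by rw [s_mul_s, mul_comm a c, ← s_mul_s]
        _ = _ := by rw [proj, neg_zero, u_zero]; noncomm_ring
    have h2 : u (-n') = u (-n) * u (n - n') := by
      rw [u_mul_u]
      congr 1
      ring
    calc s c * (star (s a) * u n * s m * star (s m) * u (-n') * s b)
        = (s c * star (s a)) * (u n * s m * star (s m) * u (-n)) * u (n - n') * s b := by
          rw [h2]
          noncomm_ring
      _ = _ := by
          rw [h1, ← proj]
          noncomm_ring
  rw [h]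
  have key : ∀ y ∈ Submodule.span ℂ (Set.range fun k => proj k (a * m)),
      star (s a) * s c * y * u (n - n') * s b ∈ Submodule.span ℂ (monomials R) := by
    intro y hy
    induction hy using Submodule.span_induction with
    | mem y hy =>
      obtain ⟨k, rfl⟩ := hy
      exact Submodule.subset_span (star_s_mul_s_mul_proj_mul_mem_monomials _ _ _ _ _ _)
    | zero => simp
    | add y z _ _ hy hz =>
      rw [mul_add, add_mul, add_mul]
      exact Submodule.add_mem _ hy hz
    | smul t y _ hy =>
      rw [mul_smul_comm, smul_mul_assoc, smul_mul_assoc]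
      exact Submodule.smul_mem _ t hy
  exact key _ (proj_mul_proj_mem_span 0 n a m)

variable (R) in
theorem dense_span_monomials :
    Dense (Submodule.span ℂ (monomials R) : Set (RegularCStarAlgebra R)) := by
  have lift : ∀ x : RegularCStarAlgebra R,
      (∀ a ∈ monomials R, x * a ∈ Submodule.span ℂ (monomials R)) →
      ∀ a ∈ Submodule.span ℂ (monomials R), x * a ∈ Submodule.span ℂ (monomials R) := by
    intro x hx a ha
    induction ha using Submodule.span_induction with
    | mem a ha => exact hx a ha
    | zero => simp
    | add a b _ _ ha hb =>
      rw [mul_add]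
      exact Submodule.add_mem _ ha hb
    | smul t a _ ha =>
      rw [mul_smul_comm]
      exact Submodule.smul_mem _ t ha
  refine dense_of_gen_mul_mem _ (Submodule.subset_span ⟨1, 1, 1, 0, 0, ?_⟩) ?_ ?_
  · simp [s_one, u_zero]
  · rintro (m | n)
    · exact lift _ fun a ha => s_mul_mem_span_monomials m ha
    · exact lift _ fun a ha => Submodule.subset_span (u_mul_mem_monomials n ha)
  · rintro (m | n)
    · exact lift _ fun a ha => Submodule.subset_span (star_s_mul_mem_monomials m ha)
    · refine lift _ fun a ha => Submodule.subset_span ?_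
      change star (u n) * a ∈ _
      rw [star_u]
      exact u_mul_mem_monomials _ ha

end Monomials

/-! ### The canonical expectations -/

variable (R : Type*) [CommRing R] [IsDomain R] [FinitePrincipalQuotients R]
  (K : Type*) [Field K] [Algebra R K] [IsFractionRing R K]

theorem isCanonicalExpectation_expectation :
    IsCanonicalExpectation R K (expectation (partialRelations R K)).toLinearMap :=
  ⟨isFaithfulConditionalExpectation (AffineGroup.folnerCondition K),
    fun l => by exact (expectation_word l).trans (by congr)⟩

variable {R K}

theorem IsCanonicalExpectation.unique
    {E E' : AffinePartialGroupAlgebra R K →ₗ[ℂ] AffinePartialGroupAlgebra R K}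
    (h : IsCanonicalExpectation R K E) (h' : IsCanonicalExpectation R K E') : E = E' := by
  refine LinearMap.eq_of_eqOn_dense_span h.expectation.norm_le h'.expectation.norm_le
    (dense_span_words _) ?_
  rintro _ ⟨l, rfl⟩
  exact (h.apply_prod l).trans (h'.apply_prod l).symm

theorem IsCuntzLiExpectation.unique {Θ Θ' : RegularCStarAlgebra R →ₗ[ℂ] RegularCStarAlgebra R}
    (h : IsCuntzLiExpectation R Θ) (h' : IsCuntzLiExpectation R Θ') : Θ = Θ' := by
  refine LinearMap.eq_of_eqOn_dense_span h.expectation.norm_le h'.expectation.norm_le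
    (dense_span_monomials R) ?_
  rintro _ ⟨m, m', m'', n, n', rfl⟩
  exact (h.apply_monomial m m' m'' n n').trans (h'.apply_monomial m m' m'' n n').symm

/-- `Ψ` maps the generators of the diagonal to the projections `e_g`. -/
theorem IsFraction.psi_diagonal {g : AffineGroup K} {m' m : R⁰} {n : R}
    (h : IsFraction R g m' n m) :
    psi R K (star (s m') * u n * s m * star (s m) * u (-n) * s m') = e g := by
  have h1 : star (s m') * u n * s m * star (s m) * u (-n) * s m' =
      (star (s m') * u n * s m) * (star (s m) * u (-n) * s m') := by noncomm_ring
  rw [h1, map_mul, h.psi_eq, h.inv.psi_eq, e]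

/-- `Ψ` maps a monomial to a word of degree `((n - n') / m'', m' / m'')`. -/
theorem psi_monomial (m m' m'' : R⁰) (n n' : R) :
    psi R K (star (s m'') * u n * s m * star (s m) * u (-n') * s m') =
      ([(pair 0 (toUnits R K m''))⁻¹, pair (algebraMap R K n) 1, pair 0 (toUnits R K m),
        (pair 0 (toUnits R K m))⁻¹, pair (algebraMap R K (-n')) 1,
        pair 0 (toUnits R K m')].map bracket).prod := by
  simp only [map_mul, map_star (psi R K), psi_s, psi_u, br, star_bracket, List.map_cons,
    List.map_nil, List.prod_cons, List.prod_nil, mul_one, mul_assoc]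

variable (R K)

/-- `Θ = Ψ⁻¹ ∘ E ∘ Ψ`. -/
def cuntzLiExpectation : RegularCStarAlgebra R →ₗ[ℂ] RegularCStarAlgebra R :=
  (phi R K).toAlgHom.toLinearMap ∘ₗ (expectation (partialRelations R K)).toLinearMap ∘ₗ
    (psi R K).toAlgHom.toLinearMap

theorem phi_psi (a : RegularCStarAlgebra R) : phi R K (psi R K a) = a :=
  DFunLike.congr_fun (phi_comp_psi R K) a

theorem psi_phi (a : AffinePartialGroupAlgebra R K) : psi R K (phi R K a) = a :=
  DFunLike.congr_fun (psi_comp_phi R K) a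

theorem isCuntzLiExpectation_cuntzLiExpectation :
    IsCuntzLiExpectation R (cuntzLiExpectation R K) where
  expectation := by
    refine (isCanonicalExpectation_expectation R K).expectation.conj _ _ (phi_psi R K)
      (psi_phi R K) ?_ ?_
    · rintro _ ⟨m, m', n, rfl⟩
      have h : IsFraction R ((pair 0 (toUnits R K m'))⁻¹ *
          pair (algebraMap R K n) (toUnits R K m)) m' n m := mul_inv_cancel_left _ _
      exact ⟨_, h.psi_diagonal.symm⟩
    · rintro _ ⟨g, rfl⟩
      obtain ⟨d, n, m, h⟩ := exists_isFraction R g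
      exact ⟨m, d, n, by rw [← h.psi_diagonal, phi_psi]⟩
  apply_monomial m m' m'' n n' := by
    classical
    change phi R K (expectation _ (psi R K _)) = _
    rw [psi_monomial, expectation_word, ← psi_monomial]
    by_cases h : m' = m'' ∧ n = n'
    · rw [if_pos h, if_pos ((prod_monomial_eq_one_iff m m' m'' n n').2 h), phi_psi, h.1, h.2]
    · rw [if_neg h, if_neg (mt (prod_monomial_eq_one_iff m m' m'' n n').1 h), map_zero]

theorem psi_cuntzLiExpectation (a : RegularCStarAlgebra R) :
    psi R K (cuntzLiExpectation R K a) = expectation _ (psi R K a) :=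
  psi_phi R K _

end RegularCStarAlgebra

end

theorem mainTheorem8 (R : Type*) [CommRing R] [IsDomain R] [FinitePrincipalQuotients R]
    (K : Type*) [Field K] [Algebra R K] [IsFractionRing R K] :
    Function.Bijective (RegularCStarAlgebra.psi R K) ∧
    (∃! E : RegularCStarAlgebra.AffinePartialGroupAlgebra R K →ₗ[ℂ]
        RegularCStarAlgebra.AffinePartialGroupAlgebra R K,
      RegularCStarAlgebra.IsCanonicalExpectation R K E) ∧
    (∃! Θ : RegularCStarAlgebra R →ₗ[ℂ] RegularCStarAlgebra R,
      RegularCStarAlgebra.IsCuntzLiExpectation R Θ) ∧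
    ∀ E Θ, RegularCStarAlgebra.IsCanonicalExpectation R K E →
      RegularCStarAlgebra.IsCuntzLiExpectation R Θ →
      (E : RegularCStarAlgebra.AffinePartialGroupAlgebra R K → _) ∘ RegularCStarAlgebra.psi R K =
        RegularCStarAlgebra.psi R K ∘ Θ := by
  have hE := RegularCStarAlgebra.isCanonicalExpectation_expectation R K
  have hΘ := RegularCStarAlgebra.isCuntzLiExpectation_cuntzLiExpectation R K
  refine ⟨RegularCStarAlgebra.psi_bijective R K, ⟨_, hE, fun E h => h.unique hE⟩,
    ⟨_, hΘ, fun Θ h => h.unique hΘ⟩, fun E Θ h h' => ?_⟩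
  rw [h.unique hE, h'.unique hΘ]
  exact funext fun a => (RegularCStarAlgebra.psi_cuntzLiExpectation R K a).symm
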